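/- For $\mathbf m=(m_1,\dots,m_d)\in\mathbb N^d$ let $\#[\mathbf m]=m_1\cdots m_d$ and let $C([\mathbf m],\ell)$ be the set of monomer-dimer tilings with exactly $\ell$ dimers of the box $[\mathbf m]=[m_1]\times\dots\times[m_d]\subset\mathbb Z^d$, i.e. of sets of $\ell$ pairwise disjoint pairs of points of $[\mathbf m]$ at $\ell^1$-distance $1$. For $p\in[0,1]$ the $p$ monomer-dimer entropy of $\mathbb Z^d$ is $$\lambda_d(p)=\lim_{i\to\infty}\frac{\log \#C([\mathbf m_i],\ell_i)}{\#[\mathbf m_i]},$$ for sequences $\mathbf m_i\in\mathbb N^d$, $\ell_i\in\mathbb Z_{\ge 0}$ such that every coordinate of $\mathbf m_i$ tends to infinity, $2\ell_i\le\#[\mathbf m_i]$, and $2\ell_i/\#[\mathbf m_i]\to p$. (By a theorem of Hammersley the limit exists and does not depend on the sequences. The inequalities below are asserted in the form that does not presuppose this: $\lambda_d(p)$ on the left is the smallest, and $\lambda_{d-1}$ on the right the largest, limit point of these quotients over all such sequences.) **Theorem.** Let $d\ge 2$ be an integer and $p\in[0,1]$. Then, with $0\log 0=0$, for each $q\in[0,p]$,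 $$\lambda_d(p)\ \ge\ \lambda_{d-1}(q)+(1-q)\log(1-q)-\frac{p-q}{2}\log\frac{p-q}{2}+\Bigl(1-\frac{p-q}{2}\Bigr)\log\Bigl(1-\frac{p-q}{2}\Bigr)-(1-p)\log(1-p).$$ In particular, $$\lambda_d(p)\ \ge\ \lambda_{d-1}\bigl(p(1-\tfrac1d)\bigr)+\bigl(1-p(1-\tfrac1d)\bigr)\log\bigl(1-p(1-\tfrac1d)\bigr)-\frac{p}{2d}\log\frac{p}{2d}+\Bigl(1-\frac{p}{2d}\Bigr)\log\Bigl(1-\frac{p}{2d}\Bigr)-(1-p)\log(1-p).$$ -/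

import Mathlib

open Filter Topology

noncomputable section

namespace MonomerDimer

/-- The box `[m] = [m₁] × ⋯ × [m_d]` in `ℤ^d` (coordinates are numbered from `0`). -/
abbrev Box {d : ℕ} (m : Fin d → ℕ) : Type := (k : Fin d) → Fin (m k)

/-- The lattice graph `G(m)` on the box: `x` and `y` are neighbours iff their `ℓ¹`-distance
is `1`. -/
def boxGraph {d : ℕ} (m : Fin d → ℕ) : SimpleGraph (Box m) where
  Adj x y := ∑ k, |((x k : ℕ) : ℤ) - ((y k : ℕ) : ℤ)| = 1
  symm := ⟨fun x y h => by
    rw [← h]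
    exact Finset.sum_congr rfl fun k _ => abs_sub_comm _ _⟩
  loopless := ⟨fun x h => by simp at h⟩

/-- The monomer-dimer tilings of the box `[m]` with exactly `l` dimers: sets of `l` edges of
`G(m)` (the dimers), no two of which share a vertex. All other points carry monomers. -/
def tilings {d : ℕ} (m : Fin d → ℕ) (l : ℕ) : Set (Finset (Sym2 (Box m))) :=
  {M | (∀ e ∈ M, e ∈ (boxGraph m).edgeSet) ∧ M.card = l ∧
    ∀ e ∈ M, ∀ f ∈ M, ∀ x : Box m, x ∈ e → x ∈ f → e = f}

/-- The number `#[m] = m₁ ⋯ m_d` of points of the box. -/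
def boxSize {d : ℕ} (m : Fin d → ℕ) : ℕ := ∏ k, m k

/-- `log #C([m], l) / #[m]`, as a function of the pair `(m, l)`. -/
def logCount {d : ℕ} (s : (Fin d → ℕ) × ℕ) : ℝ :=
  Real.log ((tilings s.1 s.2).ncard : ℝ) / (boxSize s.1 : ℝ)

/-- The filter on pairs `(m, l)` describing the limit "all sides of `[m]` tend to infinity,
the dimer density `2 l / #[m]` tends to `p`, and `2 l ≤ #[m]`" (the last condition says that `l`
dimers fit into the box; without it there is no tiling at all).
See `tendsto_densityFilter_iff` for what it means for a sequence. -/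
def densityFilter (d : ℕ) (p : ℝ) : Filter ((Fin d → ℕ) × ℕ) :=
  comap (fun s => s.1) atTop ⊓
    comap (fun s => 2 * (s.2 : ℝ) / (boxSize s.1 : ℝ)) (𝓝 p) ⊓
    𝓟 {s | 2 * s.2 ≤ boxSize s.1}

theorem tendsto_densityFilter_iff {d : ℕ} {p : ℝ} (m : ℕ → Fin d → ℕ) (l : ℕ → ℕ) :
    Tendsto (fun i => (m i, l i)) atTop (densityFilter d p) ↔
      (∀ k, Tendsto (fun i => m i k) atTop atTop) ∧
      Tendsto (fun i => 2 * (l i : ℝ) / (boxSize (m i) : ℝ)) atTop (𝓝 p) ∧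
      ∀ᶠ i in atTop, 2 * l i ≤ boxSize (m i) := by
  simp only [densityFilter, tendsto_inf, tendsto_comap_iff, tendsto_principal, Function.comp_def,
    Set.mem_ofPred_eq, and_assoc]
  refine and_congr_left fun _ => ⟨fun h k => ?_, fun h => ?_⟩
  · refine tendsto_atTop.2 fun b => ?_
    filter_upwards [tendsto_atTop.1 h (fun _ => b)] with i hi using hi k
  · refine tendsto_atTop.2 fun b => ?_
    filter_upwards [eventually_all.2 fun k => tendsto_atTop.1 (h k) (b k)] with i hi using hi

/-- For `d ≥ 1` and `p ∈ [0, 1]` there are such sequences. -/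
theorem densityFilter_neBot {d : ℕ} (hd : 1 ≤ d) {p : ℝ} (hp : p ∈ Set.Icc (0 : ℝ) 1) :
    (densityFilter d p).NeBot := by
  have hsize : ∀ i : ℕ, boxSize (fun _ : Fin d => i) = i ^ d := fun i => by simp [boxSize]
  have hN : Tendsto (fun i : ℕ => ((i ^ d : ℕ) : ℝ)) atTop atTop :=
    tendsto_natCast_atTop_atTop.comp (tendsto_pow_atTop (by omega))
  have h : Tendsto (fun i : ℕ => ((fun _ : Fin d => i), ⌊p / 2 * ((i ^ d : ℕ) : ℝ)⌋₊)) atTop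
      (densityFilter d p) := by
    refine (tendsto_densityFilter_iff _ _).2 ⟨fun _ => tendsto_id, ?_, ?_⟩
    · have h1 := ((tendsto_nat_floor_mul_div_atTop (R := ℝ) (a := p / 2)
        (by linarith [hp.1])).comp hN).const_mul 2
      simp only [hsize]
      convert h1 using 2
      · simp [mul_div_assoc]
      · ring
    · refine Eventually.of_forall fun i => ?_
      rw [hsize]
      have h2 : (⌊p / 2 * ((i ^ d : ℕ) : ℝ)⌋₊ : ℝ) ≤ p / 2 * ((i ^ d : ℕ) : ℝ) :=
        Nat.floor_le (mul_nonneg (by linarith [hp.1]) (Nat.cast_nonneg _))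
      have h3 : (0 : ℝ) ≤ ((i ^ d : ℕ) : ℝ) := Nat.cast_nonneg _
      have h4 : (2 * (⌊p / 2 * ((i ^ d : ℕ) : ℝ)⌋₊ : ℝ)) ≤ ((i ^ d : ℕ) : ℝ) := by
        nlinarith [hp.2]
      exact_mod_cast h4
  exact h.neBot

/-- The upper `p` monomer-dimer entropy on `ℤ^d`: the largest limit point of
`log #C([m_i], l_i) / #[m_i]` over all sequences of boxes growing to infinity in every direction
and dimer densities `2 l_i / #[m_i]` tending to `p`. -/
def upperEntropy (d : ℕ) (p : ℝ) : ℝ := limsup logCount (densityFilter d p)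

/-- The lower `p` monomer-dimer entropy on `ℤ^d`: the smallest limit point over all such
sequences. The entropy `λ_d(p)` is the limit of `logCount` along `densityFilter d p`, that is,
the common value of the lower and the upper entropy. -/
def lowerEntropy (d : ℕ) (p : ℝ) : ℝ := liminf logCount (densityFilter d p)

/-- Whenever the limit defining `λ_d(p)` exists, both entropies are equal to it. -/
theorem entropy_eq_of_tendsto {d : ℕ} (hd : 1 ≤ d) {p : ℝ} (hp : p ∈ Set.Icc (0 : ℝ) 1) {a : ℝ}
    (h : Tendsto logCount (densityFilter d p) (𝓝 a)) :
    lowerEntropy d p = a ∧ upperEntropy d p = a := by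
  have := densityFilter_neBot hd hp
  exact ⟨h.liminf_eq, h.limsup_eq⟩

end MonomerDimer

end

/-! Cut a box of dimension `d` into parallel layers, each a copy of a box `U` of dimension `d - 1`
with `N` points. A tiling then consists of a tiling of each layer together with, between consecutive
layers, a set `R ⊆ U` of places where dimers cross. A layer with crossing sets `R` below and `R'`
above can be filled in `layerCount R R'` ways: the two sets must be disjoint and the layer dimers
must avoid both. This defines a symmetric matrix. Restrict it to a family `S` of sets of size `r`.
By Cauchy-Schwarz the sum of all entries of its `2 ^ k`-th power is at least `|S|` times the `2 ^
k`-th power of the average row sum (`sum_transferPow_ge`), so some pair of end sets gives many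
tilings of a stack of `2 ^ k` layers (`exists_slabCount_ge`).

The average row sum is bounded below by double counting: fix a layer tiling with `l` dimers and
choose two disjoint `r`-sets among its `N - 2l` monomers. Per layer this gives the factor `C(N-2l,r)
C(N-2l-r,r) / C(N,r)`. With `2l/N ≈ q` and `r/N ≈ (p-q)/2` its logarithm is about `N * rate (1-q)
((p-q)/2)`, which by Stirling is the explicit expression in the theorem.

It remains to hit the density. Copies of one good block fill almost all of any large box, the rest
is filled nearly perfectly along a Hamiltonian path, and surplus dimers are deleted at small entropy
cost (`le_lowerEntropy`). If `p < 1`, the block is built with density slightly above `p`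
(`exists_block_of_lt_one`). If `p = 1` there is no room above `p`, and the block must be tiled
perfectly (`exists_perfect_block`). To this end the crossing sets are taken with equally many points
of each chessboard colour, they use up all monomers of every layer, and the two ends of the stack
are closed by perfectly tiled caps (`exists_cap`).

One favourable layer suffices to build a block, and the block serves every sequence of large boxes;
hence the upper entropy on the right and the lower one on the left. -/

open Filter Topology

noncomputable section

namespace MonomerDimer

/-! ### Matchings of a graph: transport, gluing, deletion, covered vertices. -/

section Matchings

variable {V W : Type*}

open Classical in
/-- The matchings of `G` with `l` edges all of whose endpoints lie in `U`. -/
def matchings (G : SimpleGraph V) (U : Finset V) (l : ℕ) : Finset (Finset (Sym2 V)) :=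
  (U.sym2.powersetCard l).filter fun M =>
    (∀ e ∈ M, e ∈ G.edgeSet) ∧ ∀ e ∈ M, ∀ f ∈ M, ∀ x, x ∈ e → x ∈ f → e = f

theorem mem_matchings {G : SimpleGraph V} {U : Finset V} {l : ℕ} {M : Finset (Sym2 V)} :
    M ∈ matchings G U l ↔ (∀ e ∈ M, ∀ x ∈ e, x ∈ U) ∧ M.card = l ∧ (∀ e ∈ M, e ∈ G.edgeSet) ∧
      ∀ e ∈ M, ∀ f ∈ M, ∀ x, x ∈ e → x ∈ f → e = f := by
  simp only [matchings, Finset.mem_filter, Finset.mem_powersetCard, Finset.subset_iff,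
    Finset.mem_sym2_iff, and_assoc]

theorem empty_mem_matchings (G : SimpleGraph V) (U : Finset V) : ∅ ∈ matchings G U 0 := by
  simp [mem_matchings]

/-- All translations, reflections and changes of model (box, lattice, prism) go through this
comparison. -/
theorem card_matchings_le_of_map (G : SimpleGraph V) (G' : SimpleGraph W) {U : Finset V}
    {U' : Finset W} (f : V → W) (hinj : Set.InjOn f U) (hU : ∀ x ∈ U, f x ∈ U')
    (hadj : ∀ x ∈ U, ∀ y ∈ U, G.Adj x y → G'.Adj (f x) (f y)) (l : ℕ) :
    (matchings G U l).card ≤ (matchings G' U' l).card := by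
  classical
  have hinj2 : Set.InjOn (Sym2.map f) (U.sym2 : Set (Sym2 V)) := by
    intro e he e' he' h
    induction e using Sym2.ind with
    | _ a b =>
    induction e' using Sym2.ind with
    | _ c d =>
    simp only [Finset.mem_coe, Finset.mk_mem_sym2_iff] at he he'
    simp only [Sym2.map_mk, Sym2.eq_iff] at h ⊢
    rcases h with ⟨h1, h2⟩ | ⟨h1, h2⟩
    · exact Or.inl ⟨hinj he.1 he'.1 h1, hinj he.2 he'.2 h2⟩
    · exact Or.inr ⟨hinj he.1 he'.2 h1, hinj he.2 he'.1 h2⟩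
  have hsub : ∀ M ∈ matchings G U l, M ⊆ U.sym2 := fun M hM e he =>
    Finset.mem_sym2_iff.2 ((mem_matchings.1 hM).1 e he)
  refine Finset.card_le_card_of_injOn (fun M => M.image (Sym2.map f)) ?_ ?_
  · intro M hM
    have hs := hsub M hM
    obtain ⟨h1, h2, h3, h4⟩ := mem_matchings.1 hM
    refine Finset.mem_coe.2 (mem_matchings.2 ⟨?_, ?_, ?_, ?_⟩)
    · intro e he x hx
      obtain ⟨e', he', rfl⟩ := Finset.mem_image.1 he
      obtain ⟨y, hy, rfl⟩ := Sym2.mem_map.1 hx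
      exact hU y (h1 e' he' y hy)
    · rw [Finset.card_image_of_injOn (hinj2.mono (by exact_mod_cast hs)), h2]
    · intro e he
      obtain ⟨e', he', rfl⟩ := Finset.mem_image.1 he
      have := h1 e' he'
      have h5 := h3 e' he'
      induction e' using Sym2.ind with
      | _ a b =>
      exact hadj a (this a (by simp)) b (this b (by simp)) h5
    · intro e he e' he' x hx hx'
      obtain ⟨g, hg, rfl⟩ := Finset.mem_image.1 he
      obtain ⟨g', hg', rfl⟩ := Finset.mem_image.1 he'
      obtain ⟨y, hy, rfl⟩ := Sym2.mem_map.1 hx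
      obtain ⟨y', hy', h⟩ := Sym2.mem_map.1 hx'
      have : y' = y := hinj (h1 g' hg' y' hy') (h1 g hg y hy) h
      subst this
      rw [h4 g hg g' hg' _ hy hy']
  · intro M hM M' hM' h
    have h' : M.image (Sym2.map f) = M'.image (Sym2.map f) := h
    have key : ∀ A B : Finset (Sym2 V), A ⊆ U.sym2 → B ⊆ U.sym2 →
        A.image (Sym2.map f) = B.image (Sym2.map f) → A ⊆ B := by
      intro A B hA hB hAB e he
      have : Sym2.map f e ∈ B.image (Sym2.map f) := hAB ▸ Finset.mem_image_of_mem _ he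
      obtain ⟨e', he', h5⟩ := Finset.mem_image.1 this
      rw [← hinj2 (hB he') (hA he) h5]
      exact he'
    exact Finset.Subset.antisymm (key _ _ (hsub M hM) (hsub M' hM') h')
      (key _ _ (hsub M' hM') (hsub M hM) h'.symm)

theorem matchings_mono (G : SimpleGraph V) {U U' : Finset V} (h : U ⊆ U') (l : ℕ) :
    matchings G U l ⊆ matchings G U' l := by
  intro M hM
  obtain ⟨h1, h2⟩ := mem_matchings.1 hM
  exact mem_matchings.2 ⟨fun e he x hx => h (h1 e he x hx), h2⟩

/-- Distinct edge sets `F i`, `i ∈ S`, between `X` and its complement, completed by matchings on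
both sides. -/
theorem sum_card_mul_card_le {ι : Type*} (G : SimpleGraph V) [DecidableEq V] (U X : Finset V)
    (S : Finset ι) (F : ι → Finset (Sym2 V)) (hF : Set.InjOn F S) (A B : ι → Finset V)
    (l₁ l₂ r : ℕ)
    (hS : ∀ i ∈ S, F i ∈ matchings G U r)
    (hcross : ∀ i ∈ S, ∀ e ∈ F i, (∃ x ∈ e, x ∈ X) ∧ ∃ x ∈ e, x ∉ X)
    (hA : ∀ i ∈ S, ∀ x ∈ A i, x ∈ U ∧ x ∈ X ∧ ∀ e ∈ F i, x ∉ e)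
    (hB : ∀ i ∈ S, ∀ x ∈ B i, x ∈ U ∧ x ∉ X ∧ ∀ e ∈ F i, x ∉ e) :
    ∑ i ∈ S, (matchings G (A i) l₁).card * (matchings G (B i) l₂).card ≤
      (matchings G U (l₁ + l₂ + r)).card := by
  classical
  simp_rw [← Finset.card_product]
  rw [← Finset.card_sigma]
  have hne : ∀ e : Sym2 V, ∃ x, x ∈ e := fun e => by
    induction e using Sym2.ind with
    | _ a b => exact ⟨a, by simp⟩
  -- membership in the pieces determines the type of the edge
  have tA : ∀ i ∈ S, ∀ M ∈ matchings G (A i) l₁, ∀ e ∈ M, (∀ x ∈ e, x ∈ X) :=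
    fun i hi M hM e he x hx => (hA i hi x ((mem_matchings.1 hM).1 e he x hx)).2.1
  have tB : ∀ i ∈ S, ∀ M ∈ matchings G (B i) l₂, ∀ e ∈ M, (∀ x ∈ e, x ∉ X) :=
    fun i hi M hM e he x hx => (hB i hi x ((mem_matchings.1 hM).1 e he x hx)).2.1
  refine Finset.card_le_card_of_injOn (fun s => F s.1 ∪ (s.2.1 ∪ s.2.2)) ?_ ?_
  · rintro ⟨i, M, M'⟩ hs
    simp only [Finset.mem_coe, Finset.mem_sigma, Finset.mem_product] at hs
    obtain ⟨hi, hM, hM'⟩ := hs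
    have hMX := tA i hi M hM
    have hMX' := tB i hi M' hM'
    have hEX := hcross i hi
    obtain ⟨e1, e2, e3, e4⟩ := mem_matchings.1 (hS i hi)
    obtain ⟨a1, a2, a3, a4⟩ := mem_matchings.1 hM
    obtain ⟨b1, b2, b3, b4⟩ := mem_matchings.1 hM'
    have dAB : ∀ e ∈ M, ∀ e' ∈ M', ∀ x, x ∈ e → x ∈ e' → False := fun e he e' he' x hx hx' =>
      hMX' e' he' x hx' (hMX e he x hx)
    have dEA : ∀ e ∈ F i, ∀ e' ∈ M, ∀ x, x ∈ e → x ∈ e' → False := fun e he e' he' x hx hx' =>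
      (hA i hi x (a1 e' he' x hx')).2.2 e he hx
    have dEB : ∀ e ∈ F i, ∀ e' ∈ M', ∀ x, x ∈ e → x ∈ e' → False := fun e he e' he' x hx hx' =>
      (hB i hi x (b1 e' he' x hx')).2.2 e he hx
    refine Finset.mem_coe.2 (mem_matchings.2 ⟨?_, ?_, ?_, ?_⟩)
    · intro e he x hx
      simp only [Finset.mem_union] at he
      rcases he with he | he | he
      · exact e1 e he x hx
      · exact (hA i hi x (a1 e he x hx)).1
      · exact (hB i hi x (b1 e he x hx)).1
    · have h1 : Disjoint M M' := Finset.disjoint_left.2 fun e he he' =>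
        let ⟨x, hx⟩ := hne e
        dAB e he e he' x hx hx
      have h2 : Disjoint (F i) (M ∪ M') := Finset.disjoint_left.2 fun e he he' => by
        obtain ⟨x, hx⟩ := hne e
        rcases Finset.mem_union.1 he' with he' | he'
        · exact dEA e he e he' x hx hx
        · exact dEB e he e he' x hx hx
      rw [Finset.card_union_of_disjoint h2, Finset.card_union_of_disjoint h1, e2, a2, b2]
      omega
    · intro e he
      simp only [Finset.mem_union] at he
      rcases he with he | he | he
      exacts [e3 e he, a3 e he, b3 e he]
    · intro e he f hf x hx hx'
      simp only [Finset.mem_union] at he hf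
      rcases he with he | he | he <;> rcases hf with hf | hf | hf
      · exact e4 e he f hf x hx hx'
      · exact (dEA e he f hf x hx hx').elim
      · exact (dEB e he f hf x hx hx').elim
      · exact (dEA f hf e he x hx' hx).elim
      · exact a4 e he f hf x hx hx'
      · exact (dAB e he f hf x hx hx').elim
      · exact (dEB f hf e he x hx' hx).elim
      · exact (dAB f hf e he x hx' hx).elim
      · exact b4 e he f hf x hx hx'
  -- The pieces of the union are recovered from the position of an edge relative to `X`: crossing,
  -- inside or outside. The crossing part is `F i`, which determines `i`.
  · have rec1 : ∀ s : (_ : ι) × (Finset (Sym2 V) × Finset (Sym2 V)),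
        s ∈ S.sigma (fun i => matchings G (A i) l₁ ×ˢ matchings G (B i) l₂) →
        F s.1 = (F s.1 ∪ (s.2.1 ∪ s.2.2)).filter (fun e => (∃ x ∈ e, x ∈ X) ∧ ∃ x ∈ e, x ∉ X) ∧
        s.2.1 = (F s.1 ∪ (s.2.1 ∪ s.2.2)).filter (fun e => ∀ x ∈ e, x ∈ X) ∧
        s.2.2 = (F s.1 ∪ (s.2.1 ∪ s.2.2)).filter (fun e => ∀ x ∈ e, x ∉ X) := by
      rintro ⟨i, M, M'⟩ hs
      simp only [Finset.mem_sigma, Finset.mem_product] at hs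
      obtain ⟨hi, hM, hM'⟩ := hs
      have hMX := tA i hi M hM
      have hMX' := tB i hi M' hM'
      have hEX := hcross i hi
      refine ⟨?_, ?_, ?_⟩
      · ext e
        simp only [Finset.mem_filter, Finset.mem_union]
        refine ⟨fun he => ⟨Or.inl he, hEX e he⟩, ?_⟩
        rintro ⟨he | he | he, ⟨x, hx, hxX⟩, ⟨y, hy, hyX⟩⟩
        · exact he
        · exact absurd (hMX e he y hy) hyX
        · exact absurd hxX (hMX' e he x hx)
      · ext e
        simp only [Finset.mem_filter, Finset.mem_union]
        refine ⟨fun he => ⟨Or.inr (Or.inl he), hMX e he⟩, ?_⟩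
        rintro ⟨he | he | he, h⟩
        · obtain ⟨_, y, hy, hyX⟩ := hEX e he
          exact absurd (h y hy) hyX
        · exact he
        · obtain ⟨x, hx⟩ := hne e
          exact absurd (h x hx) (hMX' e he x hx)
      · ext e
        simp only [Finset.mem_filter, Finset.mem_union]
        refine ⟨fun he => ⟨Or.inr (Or.inr he), hMX' e he⟩, ?_⟩
        rintro ⟨he | he | he, h⟩
        · obtain ⟨⟨y, hy, hyX⟩, _⟩ := hEX e he
          exact absurd hyX (h y hy)
        · obtain ⟨x, hx⟩ := hne e
          exact absurd (hMX e he x hx) (h x hx)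
        · exact he
    rintro ⟨i, M, M'⟩ hs ⟨j, K, K'⟩ ht h
    obtain ⟨s1, s2, s3⟩ := rec1 _ hs
    obtain ⟨t1, t2, t3⟩ := rec1 _ ht
    simp only at h s1 s2 s3 t1 t2 t3
    rw [h, ← t1] at s1
    rw [h, ← t2] at s2
    rw [h, ← t3] at s3
    obtain rfl := hF (Finset.mem_sigma.1 hs).1 (Finset.mem_sigma.1 ht).1 s1
    rw [s2, s3]

theorem card_mul_card_le (G : SimpleGraph V) {U U₁ U₂ : Finset V} (hd : Disjoint U₁ U₂)
    (h₁ : U₁ ⊆ U) (h₂ : U₂ ⊆ U) (l₁ l₂ : ℕ) :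
    (matchings G U₁ l₁).card * (matchings G U₂ l₂).card ≤ (matchings G U (l₁ + l₂)).card := by
  classical
  have := sum_card_mul_card_le G U U₁ {()} (fun _ => ∅) (by simp) (fun _ => U₁) (fun _ => U₂) l₁ l₂ 0
    (by simp [empty_mem_matchings]) (by simp) (fun E hE x hx => ⟨h₁ hx, hx, by simp_all⟩)
    (fun E hE x hx => ⟨h₂ hx, Finset.disjoint_right.1 hd hx, by simp_all⟩)
  simpa using this

/-- Deleting `j` edges of a matching. -/
theorem card_matchings_add_le (G : SimpleGraph V) (U : Finset V) (F : Finset (Sym2 V))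
    (hF : ∀ e ∈ U.sym2, e ∈ G.edgeSet → e ∈ F) (l j : ℕ) :
    (matchings G U (l + j)).card ≤ (matchings G U l).card * F.card.choose j := by
  classical
  rw [← Finset.card_powersetCard, ← Finset.card_product]
  -- Which `j` edges are deleted is immaterial: the deleted set is recorded, and `M` is the union of
  -- the two parts.
  have : ∀ M ∈ matchings G U (l + j), ∃ J ⊆ M, J.card = j := fun M hM =>
    Finset.exists_subset_card_eq (by rw [(mem_matchings.1 hM).2.1]; omega)
  choose! J hJ hJc using this
  refine Finset.card_le_card_of_injOn (fun M => (M \ J M, J M)) ?_ ?_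
  · intro M hM
    have hM' := Finset.mem_coe.1 hM
    obtain ⟨h1, h2, h3, h4⟩ := mem_matchings.1 hM'
    refine Finset.mem_coe.2 (Finset.mem_product.2 ⟨mem_matchings.2 ⟨?_, ?_, ?_, ?_⟩, ?_⟩)
    · exact fun e he => h1 e (Finset.sdiff_subset he)
    · simp only
      rw [Finset.card_sdiff_of_subset (hJ M hM'), h2, hJc M hM']
      omega
    · exact fun e he => h3 e (Finset.sdiff_subset he)
    · exact fun e he f hf => h4 e (Finset.sdiff_subset he) f (Finset.sdiff_subset hf)
    · refine Finset.mem_powersetCard.2 ⟨fun e he => ?_, hJc M hM'⟩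
      have he' := hJ M hM' he
      exact hF e (Finset.mem_sym2_iff.2 (h1 e he')) (h3 e he')
  · intro M hM M' hM' h
    simp only [Prod.mk.injEq] at h
    rw [← Finset.sdiff_union_of_subset (hJ M hM), ← Finset.sdiff_union_of_subset (hJ M' hM'),
      h.1, h.2]

open Classical in
/-- The vertices covered by a set of edges. -/
def cover (M : Finset (Sym2 V)) : Finset V := M.biUnion Sym2.toFinset

theorem mem_cover {M : Finset (Sym2 V)} {x : V} : x ∈ cover M ↔ ∃ e ∈ M, x ∈ e := by
  simp [cover]

theorem cover_subset {G : SimpleGraph V} {U : Finset V} {l : ℕ} {M : Finset (Sym2 V)}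
    (hM : M ∈ matchings G U l) : cover M ⊆ U := fun x hx => by
  obtain ⟨e, he, hx⟩ := mem_cover.1 hx
  exact (mem_matchings.1 hM).1 e he x hx

/-- Used with `c = 2` to count all covered points, and with `c = 1` for a colour class, which every
edge meets once. -/
theorem card_filter_cover {G : SimpleGraph V} {U : Finset V} {l c : ℕ} {M : Finset (Sym2 V)}
    (hM : M ∈ matchings G U l) (P : V → Prop) [DecidablePred P] [DecidableEq V]
    (hP : ∀ x y, G.Adj x y → (({x, y} : Finset V).filter P).card = c) :
    ((cover M).filter P).card = l * c := by
  classical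
  obtain ⟨h1, h2, h3, h4⟩ := mem_matchings.1 hM
  have : (cover M).filter P = M.biUnion fun e => e.toFinset.filter P := by
    ext x
    simp only [Finset.mem_filter, mem_cover, Finset.mem_biUnion, Sym2.mem_toFinset]
    tauto
  rw [this, Finset.card_biUnion]
  · rw [← h2]
    refine Finset.sum_const_nat fun e he => ?_
    have h5 := h3 e he
    induction e using Sym2.ind with
    | _ a b =>
    rw [← hP a b h5]
    congr 2
    ext
    simp
  · intro e he f hf hef
    refine Finset.disjoint_left.2 fun x hx hx' => hef ?_
    simp only [Finset.mem_filter, Sym2.mem_toFinset] at hx hx'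
    exact h4 e he f hf x hx.1 hx'.1

theorem card_cover {G : SimpleGraph V} {U : Finset V} {l : ℕ} {M : Finset (Sym2 V)}
    (hM : M ∈ matchings G U l) : (cover M).card = 2 * l := by
  classical
  have := card_filter_cover hM (fun _ => True) (c := 2) (fun x y h => by simp [h.ne])
  simpa [mul_comm] using this

theorem matchings_sdiff (G : SimpleGraph V) [DecidableEq V] (U R : Finset V) (l : ℕ) :
    matchings G (U \ R) l = (matchings G U l).filter fun M => Disjoint (cover M) R := by
  ext M
  simp only [Finset.mem_filter, mem_matchings, Finset.disjoint_left, mem_cover, Finset.mem_sdiff]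
  constructor
  · rintro ⟨h1, h2⟩
    refine ⟨⟨fun e he x hx => (h1 e he x hx).1, h2⟩, ?_⟩
    rintro x ⟨e, he, hx⟩
    exact (h1 e he x hx).2
  · rintro ⟨⟨h1, h2⟩, h3⟩
    exact ⟨fun e he x hx => ⟨h1 e he x hx, h3 ⟨e, he, hx⟩⟩, h2⟩

end Matchings

/-! ### Boxes in the lattice: superadditivity, Hamiltonian paths, extension of tilings. -/

section Lattice

/-- The nearest-neighbour graph on `ℕ^d`. -/
def lattice (d : ℕ) : SimpleGraph (Fin d → ℕ) where
  Adj x y := ∑ k, |(x k : ℤ) - (y k : ℤ)| = 1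
  symm := ⟨fun x y h => by
    rw [← h]
    exact Finset.sum_congr rfl fun k _ => abs_sub_comm _ _⟩
  loopless := ⟨fun x h => by simp at h⟩

theorem lattice_adj {d : ℕ} {x y : Fin d → ℕ} :
    (lattice d).Adj x y ↔ ∑ k, |(x k : ℤ) - (y k : ℤ)| = 1 := Iff.rfl

/-- The box `[m]` as a finite subset of `ℕ^d`. -/
def boxPts {d : ℕ} (m : Fin d → ℕ) : Finset (Fin d → ℕ) :=
  Fintype.piFinset fun k => Finset.range (m k)

theorem mem_boxPts {d : ℕ} {m x : Fin d → ℕ} : x ∈ boxPts m ↔ ∀ k, x k < m k := by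
  simp [boxPts]

theorem card_boxPts {d : ℕ} (m : Fin d → ℕ) : (boxPts m).card = boxSize m := by
  simp [boxPts, boxSize]

/-- The number of tilings of the box `[m]` with `l` dimers. -/
def boxCount {d : ℕ} (m : Fin d → ℕ) (l : ℕ) : ℕ := (matchings (lattice d) (boxPts m) l).card

theorem ncard_tilings {d : ℕ} {m : Fin d → ℕ} (hm : ∀ k, 0 < m k) (l : ℕ) :
    (tilings m l).ncard = boxCount m l := by
  have h : tilings m l = (matchings (boxGraph m) Finset.univ l : Set (Finset (Sym2 (Box m)))) := by
    ext M
    simp only [tilings, Set.mem_ofPred_eq, Finset.mem_coe, mem_matchings, Finset.mem_univ,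
      implies_true, true_and]
    tauto
  rw [h, Set.ncard_coe_finset]
  refine le_antisymm ?_ ?_
  · refine card_matchings_le_of_map _ _ (fun x k => (x k : ℕ)) ?_ ?_ ?_ l
    · exact Function.Injective.injOn fun x y h => funext fun k => Fin.ext (congrFun h k)
    · exact fun x _ => mem_boxPts.2 fun k => (x k).2
    · exact fun x _ y _ h => h
  · have hv : ∀ x ∈ boxPts m, ∀ k, x k % m k = x k := fun x hx k =>
      Nat.mod_eq_of_lt (mem_boxPts.1 hx k)
    -- Reduction modulo the sides only makes the map total; it is the identity on the box.
    refine card_matchings_le_of_map _ _ (fun x k => ⟨x k % m k, Nat.mod_lt _ (hm k)⟩) ?_ ?_ ?_ l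
    · intro x hx y hy h
      funext k
      have := congrArg Fin.val (congrFun h k)
      simpa [hv x hx k, hv y hy k] using this
    · simp
    · intro x hx y hy h
      have h' := lattice_adj.1 h
      simpa [boxGraph, hv x hx, hv y hy] using h'

/-- The edges of the lattice that leave a point of `U` in a positive direction. -/
def posEdges {d : ℕ} (U : Finset (Fin d → ℕ)) : Finset (Sym2 (Fin d → ℕ)) :=
  open Classical in
  (U ×ˢ (Finset.univ : Finset (Fin d))).image fun p => s(p.1, p.1 + Pi.single p.2 1)

theorem card_posEdges_le {d : ℕ} (U : Finset (Fin d → ℕ)) : (posEdges U).card ≤ d * U.card := by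
  classical
  refine Finset.card_image_le.trans ?_
  simp [mul_comm]

theorem exists_single_of_adj {d : ℕ} {x y : Fin d → ℕ} (h : (lattice d).Adj x y) :
    ∃ k, y = x + Pi.single k 1 ∨ x = y + Pi.single k 1 := by
  classical
  have h' := lattice_adj.1 h
  obtain ⟨k, hk⟩ : ∃ k, x k ≠ y k := by
    by_contra! hc
    exact h.ne (funext hc)
  have hk1 : 1 ≤ |(x k : ℤ) - (y k : ℤ)| := Int.one_le_abs (by omega)
  rw [← Finset.add_sum_erase _ _ (Finset.mem_univ k)] at h'
  have hnn : ∀ i ∈ Finset.univ.erase k, 0 ≤ |(x i : ℤ) - (y i : ℤ)| := fun i _ => abs_nonneg _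
  have h0 : ∑ i ∈ Finset.univ.erase k, |(x i : ℤ) - (y i : ℤ)| = 0 :=
    le_antisymm (by omega) (Finset.sum_nonneg hnn)
  have hz := (Finset.sum_eq_zero_iff_of_nonneg hnn).1 h0
  have hoff : ∀ i, i ≠ k → x i = y i := fun i hi => by
    have := abs_eq_zero.1 (hz i (by simp [hi]))
    omega
  have hk2 : |(x k : ℤ) - (y k : ℤ)| = 1 := by omega
  refine ⟨k, ?_⟩
  rcases (abs_eq (by norm_num)).1 hk2 with h2 | h2
  · right
    funext i
    by_cases hi : i = k
    · subst hi
      simp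
      omega
    · simp [hi, hoff i hi]
  · left
    funext i
    by_cases hi : i = k
    · subst hi
      simp
      omega
    · simp [hi, hoff i hi]

theorem mem_posEdges {d : ℕ} {U : Finset (Fin d → ℕ)} {e : Sym2 (Fin d → ℕ)} (he : e ∈ U.sym2)
    (h : e ∈ (lattice d).edgeSet) : e ∈ posEdges U := by
  classical
  induction e using Sym2.ind with
  | _ x y =>
  simp only [Finset.mk_mem_sym2_iff] at he
  obtain ⟨k, hk⟩ := exists_single_of_adj (x := x) (y := y) h
  rcases hk with hk | hk
  · exact Finset.mem_image.2 ⟨(x, k), by simp [he.1], by simp only [← hk]⟩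
  · exact Finset.mem_image.2 ⟨(y, k), by simp [he.2], by simp only [← hk]; exact Sym2.eq_swap⟩

theorem boxCount_add_le {d : ℕ} (m : Fin d → ℕ) (l j : ℕ) :
    boxCount m (l + j) ≤ boxCount m l * (d * boxSize m).choose j := by
  refine (card_matchings_add_le _ _ (posEdges (boxPts m)) (fun e => mem_posEdges) l j).trans ?_
  refine Nat.mul_le_mul_left _ (Nat.choose_le_choose _ ?_)
  rw [← card_boxPts]
  exact card_posEdges_le _

theorem boxCount_zero_right {d : ℕ} (m : Fin d → ℕ) : boxCount m 0 = 1 := by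
  have : matchings (lattice d) (boxPts m) 0 = {∅} := by
    ext M
    simp only [Finset.mem_singleton]
    refine ⟨fun h => Finset.card_eq_zero.1 (mem_matchings.1 h).2.1, ?_⟩
    rintro rfl
    exact empty_mem_matchings _ _
  simp [boxCount, this]

theorem boxCount_le {d : ℕ} (m : Fin d → ℕ) (l : ℕ) : boxCount m l ≤ 2 ^ (d * boxSize m) := by
  have := boxCount_add_le m 0 l
  rw [boxCount_zero_right, zero_add, one_mul] at this
  exact this.trans (Nat.choose_le_two_pow _ _)

/-- Two boxes that differ only in direction `k`, placed side by side, can be tiled independently. -/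
theorem boxCount_update_add {d : ℕ} (m : Fin d → ℕ) (k : Fin d) (a b l₁ l₂ : ℕ) :
    boxCount (Function.update m k a) l₁ * boxCount (Function.update m k b) l₂ ≤
      boxCount (Function.update m k (a + b)) (l₁ + l₂) := by
  classical
  have h1 : boxCount (Function.update m k b) l₂ ≤ (matchings (lattice d)
      ((boxPts (Function.update m k b)).map (addRightEmbedding (Pi.single k a))) l₂).card := by
    refine card_matchings_le_of_map _ _ (fun x => x + Pi.single k a)
      (add_left_injective _).injOn ?_ ?_ _
    · intro x hx
      exact Finset.mem_map.2 ⟨x, hx, rfl⟩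
    · intro x _ y _ h
      simpa [lattice_adj] using h
  refine (Nat.mul_le_mul_left _ h1).trans ?_
  refine card_mul_card_le _ ?_ ?_ ?_ _ _
  · refine Finset.disjoint_left.2 fun x hx hx' => ?_
    obtain ⟨y, _, rfl⟩ := Finset.mem_map.1 hx'
    have := mem_boxPts.1 hx k
    simp at this
  · intro x hx
    refine mem_boxPts.2 fun i => ?_
    have := mem_boxPts.1 hx i
    by_cases hi : i = k
    · subst hi
      simp at this ⊢
      omega
    · simpa [hi] using this
  · intro x hx
    obtain ⟨y, hy, rfl⟩ := Finset.mem_map.1 hx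
    refine mem_boxPts.2 fun i => ?_
    have := mem_boxPts.1 hy i
    by_cases hi : i = k
    · subst hi
      simp at this ⊢
      omega
    · simpa [hi] using this

theorem boxSize_update {d : ℕ} (m : Fin d → ℕ) (k : Fin d) (a : ℕ) :
    boxSize (Function.update m k a) * m k = boxSize m * a := by
  classical
  simp only [boxSize]
  rw [Finset.prod_update_of_mem (Finset.mem_univ k), ← Finset.mul_prod_erase _ _ (Finset.mem_univ k),
    Finset.sdiff_singleton_eq_erase]
  ring

theorem boxCount_pow_update {d : ℕ} (m : Fin d → ℕ) (k : Fin d) (l a : ℕ) :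
    boxCount m l ^ a ≤ boxCount (Function.update m k (a * m k)) (a * l) := by
  induction a with
  | zero => simp [boxCount_zero_right]
  | succ a ih =>
    have := boxCount_update_add m k (a * m k) (m k) (a * l) l
    rw [Function.update_eq_self] at this
    rw [pow_succ, Nat.succ_mul, Nat.succ_mul]
    exact (Nat.mul_le_mul_right _ ih).trans this

/-- Filling a box by translates of a smaller one. -/
theorem boxCount_pow_le {d : ℕ} (b a : Fin d → ℕ) (l : ℕ) :
    boxCount b l ^ (∏ k, a k) ≤ boxCount (fun k => a k * b k) ((∏ k, a k) * l) := by
  classical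
  suffices h : ∀ s : Finset (Fin d), boxCount b l ^ (∏ k ∈ s, a k) ≤
      boxCount (fun k => if k ∈ s then a k * b k else b k) ((∏ k ∈ s, a k) * l) by
    simpa using h Finset.univ
  intro s
  induction s using Finset.induction_on with
  | empty => simp
  | insert k s hk ih =>
    rw [Finset.prod_insert hk, mul_comm (a k), pow_mul]
    refine (Nat.pow_le_pow_left ih (a k)).trans ((boxCount_pow_update _ k _ _).trans (le_of_eq ?_))
    congr 1
    · funext i
      by_cases hi : i = k
      · subst hi
        simp [hk]
      · simp [hi]
    · ring

/-- `f` enumerates `U` along a path of `G`. -/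
structure IsHamPath {V : Type*} [DecidableEq V] (G : SimpleGraph V) (U : Finset V) (f : ℕ → V) :
    Prop where
  image_eq : (Finset.range U.card).image f = U
  adj : ∀ i, i + 1 < U.card → G.Adj (f i) (f (i + 1))

namespace IsHamPath

variable {V : Type*} [DecidableEq V] {G : SimpleGraph V} {U : Finset V} {f : ℕ → V}

theorem injOn (h : IsHamPath G U f) : Set.InjOn f (Finset.range U.card) :=
  Finset.card_image_iff.1 (by rw [h.image_eq, Finset.card_range])

theorem mem (h : IsHamPath G U f) {i : ℕ} (hi : i < U.card) : f i ∈ U := by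
  have := Finset.mem_image_of_mem f (Finset.mem_range.2 hi)
  rwa [h.image_eq] at this

theorem matchings_segment_nonempty (h : IsHamPath G U f) (i k : ℕ) (hik : i + 2 * k ≤ U.card) :
    (matchings G ((Finset.Ico i (i + 2 * k)).image f) k).Nonempty := by
  induction k with
  | zero => exact ⟨∅, by simp [mem_matchings]⟩
  | succ k ih =>
    have ih := ih (by omega)
    rw [← Finset.card_pos] at ih ⊢
    have h2 : (matchings G {f (i + 2 * k), f (i + 2 * k + 1)} 1).Nonempty := by
      refine ⟨{s(f (i + 2 * k), f (i + 2 * k + 1))}, mem_matchings.2 ⟨?_, by simp, ?_, ?_⟩⟩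
      · simp
      · simpa using h.adj (i + 2 * k) (by omega)
      · simp
    rw [← Finset.card_pos] at h2
    refine (Nat.mul_pos ih h2).trans_le (card_mul_card_le G ?_ ?_ ?_ _ _)
    · refine Finset.disjoint_left.2 fun x hx hx' => ?_
      obtain ⟨j, hj, rfl⟩ := Finset.mem_image.1 hx
      simp only [Finset.mem_insert, Finset.mem_singleton] at hx'
      rw [Finset.mem_Ico] at hj
      rcases hx' with hx' | hx'
      · have := h.injOn (by simp; omega) (by simp; omega) hx'
        omega
      · have := h.injOn (by simp; omega) (by simp; omega) hx'
        omega
    · exact Finset.image_subset_image (Finset.Ico_subset_Ico_right (by omega))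
    · intro x hx
      simp only [Finset.mem_insert, Finset.mem_singleton] at hx
      rcases hx with rfl | rfl <;> exact Finset.mem_image_of_mem _ (Finset.mem_Ico.2 (by omega))

theorem matchings_nonempty (h : IsHamPath G U f) : (matchings G U (U.card / 2)).Nonempty := by
  obtain ⟨M, hM⟩ := h.matchings_segment_nonempty 0 (U.card / 2) (by omega)
  refine ⟨M, matchings_mono G ?_ _ hM⟩
  intro x hx
  obtain ⟨j, hj, rfl⟩ := Finset.mem_image.1 hx
  rw [Finset.mem_Ico] at hj
  exact h.mem (by omega)

end IsHamPath

theorem lattice_adj_cons {d : ℕ} {s t : ℕ} {x y : Fin d → ℕ} :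
    (lattice (d + 1)).Adj (Fin.cons s x : Fin (d + 1) → ℕ) (Fin.cons t y : Fin (d + 1) → ℕ) ↔
      |(s : ℤ) - t| + ∑ k, |(x k : ℤ) - (y k : ℤ)| = 1 := by
  rw [lattice_adj, Fin.sum_univ_succ]
  simp

theorem boxSize_cons {d : ℕ} (a : ℕ) (m : Fin d → ℕ) :
    boxSize (Fin.cons a m : Fin (d + 1) → ℕ) = a * boxSize m := by
  simp [boxSize, Fin.prod_univ_succ]

theorem cons_mem_boxPts {d : ℕ} {a t : ℕ} {m x : Fin d → ℕ} :
    (Fin.cons t x : Fin (d + 1) → ℕ) ∈ boxPts (Fin.cons a m : Fin (d + 1) → ℕ) ↔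
      t < a ∧ x ∈ boxPts m := by
  simp [mem_boxPts, Fin.forall_fin_succ]

/-- The boustrophedon path through a box. -/
theorem exists_isHamPath {d : ℕ} (m : Fin d → ℕ) :
    ∃ f, IsHamPath (lattice d) (boxPts m) f := by
  induction d with
  | zero =>
    refine ⟨fun _ => 0, ?_, ?_⟩
    · rw [card_boxPts]
      ext x
      simp [boxSize, mem_boxPts, Subsingleton.elim x 0]
    · rw [card_boxPts]
      simp [boxSize]
  | succ d ih =>
    obtain ⟨a, m, rfl⟩ : ∃ a m', m = (Fin.cons a m' : Fin (d + 1) → ℕ) :=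
      ⟨m 0, Fin.tail m, (Fin.cons_self_tail m).symm⟩
    obtain ⟨g, hg⟩ := ih m
    set N := (boxPts m).card with hN
    have hcard : (boxPts (Fin.cons a m : Fin (d + 1) → ℕ)).card = a * N := by
      rw [card_boxPts, boxSize_cons, hN, card_boxPts]
    -- Layers with even index are traversed forwards, those with odd index backwards, so consecutive
    -- layers meet at equal points.
    let σ : ℕ → ℕ := fun i => if Even (i / N) then i % N else N - 1 - i % N
    refine ⟨fun i => Fin.cons (i / N) (g (σ i)), ?_, ?_⟩
    · rw [hcard]
      ext z
      obtain ⟨t, x, rfl⟩ : ∃ a m', z = (Fin.cons a m' : Fin (d + 1) → ℕ) :=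
        ⟨z 0, Fin.tail z, (Fin.cons_self_tail z).symm⟩
      simp only [Finset.mem_image, Finset.mem_range, cons_mem_boxPts, Fin.cons_inj]
      constructor
      · rintro ⟨i, hi, rfl, rfl⟩
        have hNpos : 0 < N := Nat.pos_of_ne_zero (by rintro h; simp [h] at hi)
        have hm := Nat.mod_lt i hNpos
        refine ⟨Nat.div_lt_of_lt_mul (by rwa [mul_comm] at hi), hg.mem ?_⟩
        simp only [σ]
        split_ifs <;> omega
      · rintro ⟨ht, hx⟩
        rw [← hg.image_eq] at hx
        obtain ⟨j, hj, rfl⟩ := Finset.mem_image.1 hx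
        rw [Finset.mem_range, ← hN] at hj
        have hdiv : ∀ k < N, (t * N + k) / N = t := fun k hk => by
          rw [mul_comm, Nat.mul_add_div (by omega), Nat.div_eq_of_lt hk, add_zero]
        have hmod : ∀ k < N, (t * N + k) % N = k := fun k hk => by
          rw [mul_comm, Nat.mul_add_mod, Nat.mod_eq_of_lt hk]
        have hlt : ∀ k < N, t * N + k < a * N := fun k hk => by nlinarith
        by_cases he : Even t
        · exact ⟨t * N + j, hlt j hj, hdiv j hj, by simp [σ, hdiv j hj, he, hmod j hj]⟩
        · have hj' : N - 1 - j < N := by omega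
          refine ⟨t * N + (N - 1 - j), hlt _ hj', hdiv _ hj', ?_⟩
          simp only [σ, hdiv _ hj', he, hmod _ hj', if_false]
          congr 1
          omega
    · rw [hcard]
      intro i hi
      have hNpos : 0 < N := Nat.pos_of_ne_zero (by rintro h; simp [h] at hi)
      rw [lattice_adj_cons]
      have hm := Nat.mod_lt i hNpos
      by_cases hc : i % N + 1 < N
      · have h1 : (i + 1) / N = i / N := by
          rw [Nat.succ_div_of_not_dvd]
          intro hd
          have := Nat.mod_add_div i N
          have h2 : (i % N + 1) % N = 0 := by
            rw [Nat.mod_add_mod]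
            exact Nat.mod_eq_zero_of_dvd hd
          rw [Nat.mod_eq_of_lt hc] at h2
          omega
        have h2 : (i + 1) % N = i % N + 1 := by
          rw [← Nat.mod_add_mod, Nat.mod_eq_of_lt hc]
        simp only [h1, sub_self, abs_zero, zero_add]
        rw [← lattice_adj]
        by_cases he : Even (i / N)
        · simp only [σ, h1, he, h2, if_true]
          exact hg.adj _ (by omega)
        · simp only [σ, h1, he, h2, if_false]
          have := hg.adj (N - 1 - (i % N + 1)) (by omega)
          rw [show N - 1 - (i % N + 1) + 1 = N - 1 - i % N by omega] at this
          exact this.symm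
      · have hc' : i % N = N - 1 := by omega
        have hi' : i + 1 = N * (i / N + 1) := by
          have := Nat.mod_add_div i N
          rw [mul_add, mul_one]
          omega
        have h1 : (i + 1) / N = i / N + 1 := by rw [hi', Nat.mul_div_cancel_left _ hNpos]
        have h2 : (i + 1) % N = 0 := by rw [hi', Nat.mul_mod_right]
        have h3 : σ (i + 1) = σ i := by
          by_cases he : Even (i / N)
          · have : ¬ Even (i / N + 1) := by simp [Nat.even_add_one, he]
            simp [σ, h1, h2, he, hc', this]
          · have : Even (i / N + 1) := by simpa [Nat.even_add_one] using he
            simp [σ, h1, h2, he, hc', this]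
        rw [h3, h1]
        simp

/-- Pairing consecutive points of a Hamiltonian path leaves at most one point uncovered. -/
theorem boxCount_half_pos {d : ℕ} (m : Fin d → ℕ) : 0 < boxCount m (boxSize m / 2) := by
  obtain ⟨f, hf⟩ := exists_isHamPath m
  rw [← card_boxPts]
  exact Finset.card_pos.2 hf.matchings_nonempty

theorem boxSize_update_add {d : ℕ} (m : Fin d → ℕ) (k : Fin d) (a b : ℕ) :
    boxSize (Function.update m k (a + b)) =
      boxSize (Function.update m k a) + boxSize (Function.update m k b) := by
  simp only [boxSize, Finset.prod_update_of_mem (Finset.mem_univ k), add_mul]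

/-- A tiling of a box with even sides extends to every larger box, leaving at most one
additional monomer. -/
theorem exists_boxCount_le {d : ℕ} {b m : Fin d → ℕ} (hb : ∀ k, Even (b k)) (hbm : ∀ k, b k ≤ m k)
    (l : ℕ) : ∃ t, boxCount b l ≤ boxCount m t ∧ 2 * t + boxSize b ≤ boxSize m + 2 * l ∧
      boxSize m + 2 * l ≤ 2 * t + boxSize b + 1 := by
  classical
  -- The sides are enlarged one direction at a time. As long as some direction keeps its even side,
  -- the added piece has an even number of points and is covered perfectly; only the last
  -- enlargement can cost a monomer.
  suffices h : ∀ s : Finset (Fin d), ∃ t,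
      boxCount b l ≤ boxCount (fun k => if k ∈ s then m k else b k) t ∧
      2 * t + boxSize b ≤ boxSize (fun k => if k ∈ s then m k else b k) + 2 * l ∧
      boxSize (fun k => if k ∈ s then m k else b k) + 2 * l ≤ 2 * t + boxSize b + 1 ∧
      (s ≠ Finset.univ →
        2 * t + boxSize b = boxSize (fun k => if k ∈ s then m k else b k) + 2 * l) by
    obtain ⟨t, h1, h2, h3, -⟩ := h Finset.univ
    simp only [Finset.mem_univ, if_true] at h1 h2 h3
    exact ⟨t, h1, h2, h3⟩
  intro s
  induction s using Finset.induction_on with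
  | empty =>
    have he : (fun k => if k ∈ (∅ : Finset (Fin d)) then m k else b k) = b := by
      funext k
      simp
    rw [he]
    exact ⟨l, le_rfl, by omega, by omega, fun _ => by omega⟩
  | insert k s hk ih =>
    obtain ⟨t, h1, -, -, h4⟩ := ih
    have h4 := h4 (by rintro rfl; simp at hk)
    set c : Fin d → ℕ := fun k => if k ∈ s then m k else b k with hc
    have hck : c k = b k := by simp [hc, hk]
    have hc' : (fun i => if i ∈ insert k s then m i else b i) =
        Function.update c k (b k + (m k - b k)) := by
      funext i
      by_cases hi : i = k
      · subst hi
        simp [hbm i]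
      · simp [hi, hc]
    have hcc : Function.update c k (b k) = c := by rw [← hck, Function.update_eq_self]
    have hsz := boxSize_update_add c k (b k) (m k - b k)
    have hct := boxCount_update_add c k (b k) (m k - b k) t
      (boxSize (Function.update c k (m k - b k)) / 2)
    have hpos := boxCount_half_pos (Function.update c k (m k - b k))
    rw [hcc] at hsz hct
    rw [hc', hsz]
    refine ⟨t + boxSize (Function.update c k (m k - b k)) / 2,
      h1.trans ((Nat.le_mul_of_pos_right _ hpos).trans hct), by omega, by omega, fun hne => ?_⟩
    obtain ⟨i, hi⟩ : ∃ i, i ∉ insert k s := by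
      by_contra! h
      exact hne (Finset.eq_univ_of_forall h)
    simp only [Finset.mem_insert, not_or] at hi
    have hev : Even (boxSize (Function.update c k (m k - b k))) := by
      rw [even_iff_two_dvd]
      refine dvd_trans ?_ (Finset.dvd_prod_of_mem _ (Finset.mem_univ i))
      simpa [hi.1, hi.2, hc, ← even_iff_two_dvd] using hb i
    obtain ⟨e, he⟩ := hev
    omega

end Lattice

/-! ### Stacks of layers and the transfer matrix. -/

section Transfer

variable {V : Type*}

/-- The product of the path graph on `ℕ` with `G`. -/
def prism (G : SimpleGraph V) : SimpleGraph (ℕ × V) where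
  Adj a b := (a.1 = b.1 ∧ G.Adj a.2 b.2) ∨ (a.2 = b.2 ∧ (a.1 + 1 = b.1 ∨ b.1 + 1 = a.1))
  symm := ⟨fun a b h => by
    rcases h with ⟨h1, h2⟩ | ⟨h1, h2⟩
    · exact Or.inl ⟨h1.symm, h2.symm⟩
    · exact Or.inr ⟨h1.symm, h2.symm⟩⟩
  loopless := ⟨fun a h => by
    rcases h with ⟨_, h2⟩ | ⟨_, h2⟩
    · exact G.loopless.irrefl _ h2
    · omega⟩

variable [DecidableEq V]

/-- `n` copies of `U`, with `R` removed from the first and `R'` from the last one. -/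
def slab (U : Finset V) (n : ℕ) (R R' : Finset V) : Finset (ℕ × V) :=
  (Finset.range n ×ˢ U).filter fun a => (a.1 = 0 → a.2 ∉ R) ∧ (a.1 + 1 = n → a.2 ∉ R')

theorem mem_slab {U : Finset V} {n : ℕ} {R R' : Finset V} {a : ℕ × V} :
    a ∈ slab U n R R' ↔
      (a.1 < n ∧ a.2 ∈ U) ∧ (a.1 = 0 → a.2 ∉ R) ∧ (a.1 + 1 = n → a.2 ∉ R') := by
  simp [slab]

/-- The number of matchings of a slab with `l` edges; the two removed sets must not overlap. -/
def slabCount (G : SimpleGraph V) (U : Finset V) (n l : ℕ) (R R' : Finset V) : ℕ :=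
  if n = 1 ∧ ¬ Disjoint R R' then 0 else (matchings (prism G) (slab U n R R') l).card

theorem slabCount_le (G : SimpleGraph V) (U : Finset V) (n l : ℕ) (R R' : Finset V) :
    slabCount G U n l R R' ≤ (matchings (prism G) (slab U n R R') l).card := by
  unfold slabCount
  split_ifs <;> simp

/-- Two slabs are joined by vertical dimers over `R`. Different `R` give different sets of crossing
dimers, so the contributions add up. -/
theorem sum_slabCount_mul_le (G : SimpleGraph V) {U : Finset V} {S : Finset (Finset V)} {r : ℕ}
    (hSU : ∀ R ∈ S, R ⊆ U) (hSr : ∀ R ∈ S, R.card = r) {n₁ n₂ : ℕ} (h₁ : 0 < n₁) (h₂ : 0 < n₂)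
    (l₁ l₂ : ℕ) (A B : Finset V) :
    ∑ R ∈ S, slabCount G U n₁ l₁ A R * slabCount G U n₂ l₂ R B ≤
      slabCount G U (n₁ + n₂) (l₁ + l₂ + r) A B := by
  classical
  -- If a slab is a single layer, its two removed sets lie in that layer. The terms where they
  -- overlap vanish by the convention in `slabCount`, and only for the others do the vertical dimers
  -- fit.
  set S' := S.filter fun R => (n₁ = 1 → Disjoint A R) ∧ (n₂ = 1 → Disjoint R B) with hS'
  have hsum : ∑ R ∈ S, slabCount G U n₁ l₁ A R * slabCount G U n₂ l₂ R B =
      ∑ R ∈ S', slabCount G U n₁ l₁ A R * slabCount G U n₂ l₂ R B := by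
    refine (Finset.sum_filter_of_ne fun R _ h => ?_).symm
    have h1 := left_ne_zero_of_mul h
    have h2 := right_ne_zero_of_mul h
    unfold slabCount at h1 h2
    rw [ne_eq, ite_eq_left_iff, Classical.not_imp] at h1 h2
    tauto
  rw [hsum, slabCount, if_neg (by omega)]
  let sh : ℕ × V → ℕ × V := fun a => (a.1 + n₁, a.2)
  let vert : V → Sym2 (ℕ × V) := fun x => s((n₁ - 1, x), (n₁, x))
  have hvert : Function.Injective vert := by
    intro x y h
    simp only [vert, Sym2.eq_iff, Prod.mk.injEq] at h
    tauto
  have hmv : ∀ (a : ℕ × V) x, a ∈ vert x ↔ a = (n₁ - 1, x) ∨ a = (n₁, x) := fun a x => Sym2.mem_iff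
  have hshift : ∀ R, (matchings (prism G) (slab U n₂ R B) l₂).card ≤
      (matchings (prism G) ((slab U n₂ R B).image sh) l₂).card := fun R => by
    refine card_matchings_le_of_map _ _ sh ?_ (fun x hx => Finset.mem_image_of_mem _ hx) ?_ _
    · intro a _ b _ h
      simp only [sh, Prod.mk.injEq, add_left_inj] at h
      exact Prod.ext h.1 h.2
    · intro a _ b _ h
      rcases h with ⟨h1, h2⟩ | ⟨h1, h2⟩
      · exact Or.inl ⟨by simp only [sh]; omega, h2⟩
      · exact Or.inr ⟨h1, by simp only [sh]; omega⟩
  refine (Finset.sum_le_sum fun R _ => Nat.mul_le_mul (slabCount_le G U n₁ l₁ A R)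
    ((slabCount_le G U n₂ l₂ R B).trans (hshift R))).trans ?_
  refine sum_card_mul_card_le (prism G) _ (Finset.range n₁ ×ˢ U) S' (fun R => R.image vert) ?_
    (fun R => slab U n₁ A R) (fun R => (slab U n₂ R B).image sh) l₁ l₂ r ?_ ?_ ?_ ?_
  · exact (Finset.image_injective hvert).injOn
  · intro R hR
    obtain ⟨hR, hd1, hd2⟩ := Finset.mem_filter.1 hR
    refine mem_matchings.2 ⟨?_, ?_, ?_, ?_⟩
    · intro e he a ha
      obtain ⟨x, hx, rfl⟩ := Finset.mem_image.1 he
      rcases (hmv a x).1 ha with rfl | rfl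
      · refine mem_slab.2 ⟨⟨by simp only; omega, hSU R hR hx⟩, fun h => ?_, fun h => ?_⟩
        · exact Finset.disjoint_right.1 (hd1 (by simp only at h; omega)) hx
        · simp only at h
          omega
      · refine mem_slab.2 ⟨⟨by simp only; omega, hSU R hR hx⟩, fun h => ?_, fun h => ?_⟩
        · simp only at h
          omega
        · exact Finset.disjoint_left.1 (hd2 (by simp only at h; omega)) hx
    · rw [Finset.card_image_of_injective _ hvert, hSr R hR]
    · intro e he
      obtain ⟨x, hx, rfl⟩ := Finset.mem_image.1 he
      exact Or.inr ⟨rfl, Or.inl (by simp only; omega)⟩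
    · intro e he f hf a ha ha'
      obtain ⟨x, hx, rfl⟩ := Finset.mem_image.1 he
      obtain ⟨y, hy, rfl⟩ := Finset.mem_image.1 hf
      have hx2 : a.2 = x := by rcases (hmv a x).1 ha with rfl | rfl <;> rfl
      have hy2 : a.2 = y := by rcases (hmv a y).1 ha' with rfl | rfl <;> rfl
      rw [← hx2, ← hy2]
  · intro R hR e he
    obtain ⟨x, hx, rfl⟩ := Finset.mem_image.1 he
    have hxU := hSU R (Finset.mem_filter.1 hR).1 hx
    exact ⟨⟨_, (hmv _ x).2 (Or.inl rfl), by simp [hxU]; omega⟩,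
      ⟨_, (hmv _ x).2 (Or.inr rfl), by simp⟩⟩
  · intro R hR a ha
    obtain ⟨⟨h1, h2⟩, h3, h4⟩ := mem_slab.1 ha
    refine ⟨mem_slab.2 ⟨⟨by omega, h2⟩, h3, fun h => by omega⟩, by simp [h1, h2], ?_⟩
    intro e he hae
    obtain ⟨x, hx, rfl⟩ := Finset.mem_image.1 he
    rcases (hmv a x).1 hae with rfl | rfl
    · exact h4 (by simp only; omega) hx
    · exact lt_irrefl _ h1
  · intro R hR a ha
    obtain ⟨b, hb, rfl⟩ := Finset.mem_image.1 ha
    obtain ⟨⟨h1, h2⟩, h3, h4⟩ := mem_slab.1 hb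
    refine ⟨mem_slab.2 ⟨⟨by simp only [sh]; omega, h2⟩, fun h => ?_, fun h => h4 ?_⟩, by simp [sh], ?_⟩
    · simp only [sh] at h
      omega
    · simp only [sh] at h
      omega
    · intro e he hae
      obtain ⟨x, hx, rfl⟩ := Finset.mem_image.1 he
      simp only [hmv, sh, Prod.mk.injEq] at hae
      rcases hae with ⟨h, _⟩ | ⟨h, rfl⟩
      · omega
      · exact h3 (by omega) hx

theorem slabCount_mul_le (G : SimpleGraph V) {U R : Finset V} (hRU : R ⊆ U) {n₁ n₂ : ℕ}
    (h₁ : 0 < n₁) (h₂ : 0 < n₂) (l₁ l₂ : ℕ) (A B : Finset V) :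
    slabCount G U n₁ l₁ A R * slabCount G U n₂ l₂ R B ≤
      slabCount G U (n₁ + n₂) (l₁ + l₂ + R.card) A B := by
  have := sum_slabCount_mul_le G (U := U) (S := {R}) (r := R.card) (by simpa) (by simp) h₁ h₂ l₁ l₂
    A B
  simpa using this

/-- The symmetric transfer matrix between sets of vertical dimers below and above a layer. -/
def layerCount (G : SimpleGraph V) (U : Finset V) (l : ℕ) (R R' : Finset V) : ℕ :=
  if Disjoint R R' then (matchings G (U \ (R ∪ R')) l).card else 0

theorem layerCount_comm (G : SimpleGraph V) (U : Finset V) (l : ℕ) (R R' : Finset V) :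
    layerCount G U l R R' = layerCount G U l R' R := by
  simp only [layerCount, disjoint_comm, Finset.union_comm]

theorem layerCount_le_slabCount (G : SimpleGraph V) (U : Finset V) (l : ℕ) (R R' : Finset V) :
    layerCount G U l R R' ≤ slabCount G U 1 l R R' := by
  unfold layerCount slabCount
  by_cases h : Disjoint R R'
  · rw [if_pos h, if_neg (by tauto)]
    refine card_matchings_le_of_map _ _ (fun x => (0, x)) (Prod.mk_right_injective 0).injOn ?_ ?_ _
    · intro x hx
      simp only [Finset.mem_sdiff, Finset.mem_union, not_or] at hx
      exact mem_slab.2 ⟨⟨by simp, hx.1⟩, fun _ => hx.2.1, fun _ => hx.2.2⟩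
    · exact fun x _ y _ h => Or.inl ⟨rfl, h⟩
  · simp [h]

theorem slabCount_comm (G : SimpleGraph V) (U : Finset V) (n l : ℕ) (R R' : Finset V) :
    slabCount G U n l R R' ≤ slabCount G U n l R' R := by
  unfold slabCount
  simp only [disjoint_comm (a := R')]
  split_ifs with h
  · rfl
  · refine card_matchings_le_of_map _ _ (fun a => (n - 1 - a.1, a.2)) ?_ ?_ ?_ _
    · intro a ha b hb h
      have ha := (mem_slab.1 (Finset.mem_coe.1 ha)).1.1
      have hb := (mem_slab.1 (Finset.mem_coe.1 hb)).1.1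
      simp only [Prod.mk.injEq] at h
      exact Prod.ext (by omega) h.2
    · intro a ha
      obtain ⟨⟨h1, h2⟩, h3, h4⟩ := mem_slab.1 ha
      refine mem_slab.2 ⟨⟨by simp only; omega, h2⟩, fun h => h4 ?_, fun h => h3 ?_⟩ <;>
      · simp only at h
        omega
    · intro a ha b hb h
      have ha := (mem_slab.1 ha).1.1
      have hb := (mem_slab.1 hb).1.1
      rcases h with ⟨h1, h2⟩ | ⟨h1, h2⟩
      · exact Or.inl ⟨by simp only; omega, h2⟩
      · exact Or.inr ⟨h1, by simp only; omega⟩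

/-- The entries of the `2 ^ k`-th power of the transfer matrix restricted to `S`. -/
def transferPow (G : SimpleGraph V) (U : Finset V) (l : ℕ) (S : Finset (Finset V)) :
    ℕ → Finset V → Finset V → ℕ
  | 0 => layerCount G U l
  | k + 1 => fun A B => ∑ R ∈ S, transferPow G U l S k A R * transferPow G U l S k R B

theorem transferPow_comm (G : SimpleGraph V) (U : Finset V) (l : ℕ) (S : Finset (Finset V)) (k : ℕ)
    (A B : Finset V) : transferPow G U l S k A B = transferPow G U l S k B A := by
  induction k generalizing A B with
  | zero => exact layerCount_comm G U l A B
  | succ k ih =>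
    simp only [transferPow]
    refine Finset.sum_congr rfl fun R _ => ?_
    rw [ih A R, ih R B, mul_comm]

theorem transferPow_le (G : SimpleGraph V) {U : Finset V} (l : ℕ) {S : Finset (Finset V)} {r : ℕ}
    (hSU : ∀ R ∈ S, R ⊆ U) (hSr : ∀ R ∈ S, R.card = r) (k : ℕ) (A B : Finset V) :
    transferPow G U l S k A B ≤ slabCount G U (2 ^ k) (2 ^ k * l + (2 ^ k - 1) * r) A B := by
  induction k generalizing A B with
  | zero => simpa [transferPow] using layerCount_le_slabCount G U l A B
  | succ k ih =>
    have hpos : 0 < 2 ^ k := by positivity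
    have h := sum_slabCount_mul_le G hSU hSr hpos hpos (2 ^ k * l + (2 ^ k - 1) * r)
      (2 ^ k * l + (2 ^ k - 1) * r) A B
    have e1 : (2 ^ k * l + (2 ^ k - 1) * r) + (2 ^ k * l + (2 ^ k - 1) * r) + r =
        2 ^ (k + 1) * l + (2 ^ (k + 1) - 1) * r := by
      obtain ⟨a, ha⟩ : ∃ a, 2 ^ k = a + 1 := ⟨2 ^ k - 1, by omega⟩
      rw [pow_succ, ha, show (a + 1) * 2 - 1 = 2 * a + 1 by omega, Nat.add_sub_cancel]
      ring
    rw [e1, ← two_mul, ← pow_succ'] at h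
    exact (Finset.sum_le_sum fun R _ => Nat.mul_le_mul (ih A R) (ih R B)).trans h

/-- The power iteration bound for a symmetric matrix. -/
theorem sum_transferPow_ge (G : SimpleGraph V) (U : Finset V) (l : ℕ) (S : Finset (Finset V))
    (hS : S.Nonempty) (k : ℕ) :
    (S.card : ℝ) * ((∑ A ∈ S, ∑ B ∈ S, (layerCount G U l A B : ℝ)) / S.card) ^ 2 ^ k ≤
      ∑ A ∈ S, ∑ B ∈ S, (transferPow G U l S k A B : ℝ) := by
  have hc : (0 : ℝ) < S.card := by exact_mod_cast hS.card_pos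
  induction k with
  | zero =>
    simp only [transferPow, pow_zero, pow_one]
    rw [mul_div_cancel₀ _ hc.ne']
  | succ k ih =>
    set c : Finset V → ℝ := fun R => ∑ A ∈ S, (transferPow G U l S k A R : ℝ) with hcdef
    -- By symmetry row and column sums agree, so the entries of the squared matrix add up to the sum
    -- of squared column sums; Cauchy-Schwarz then applies.
    have h1 : ∑ A ∈ S, ∑ B ∈ S, (transferPow G U l S (k + 1) A B : ℝ) = ∑ R ∈ S, c R ^ 2 := by
      simp only [transferPow, Nat.cast_sum, Nat.cast_mul]
      calc _ = ∑ A ∈ S, ∑ R ∈ S, ∑ B ∈ S,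
            (transferPow G U l S k A R : ℝ) * transferPow G U l S k R B :=
            Finset.sum_congr rfl fun A _ => Finset.sum_comm
        _ = ∑ R ∈ S, ∑ A ∈ S, ∑ B ∈ S,
            (transferPow G U l S k A R : ℝ) * transferPow G U l S k R B := Finset.sum_comm
        _ = _ := Finset.sum_congr rfl fun R _ => by
            rw [sq, hcdef, Finset.sum_mul_sum]
            simp only [transferPow_comm G U l S k R]
    have h2 : ∑ A ∈ S, ∑ B ∈ S, (transferPow G U l S k A B : ℝ) = ∑ R ∈ S, c R := Finset.sum_comm
    rw [h2] at ih
    have h3 : (∑ R ∈ S, c R) ^ 2 ≤ S.card * ∑ R ∈ S, c R ^ 2 := sq_sum_le_card_mul_sum_sq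
    rw [h1, pow_succ, pow_mul]
    set x := ((∑ A ∈ S, ∑ B ∈ S, (layerCount G U l A B : ℝ)) / S.card) ^ 2 ^ k
    have hx : 0 ≤ x := by positivity
    have h4 : (S.card * x) ^ 2 ≤ S.card * ∑ R ∈ S, c R ^ 2 :=
      (pow_le_pow_left₀ (by positivity) ih 2).trans h3
    refine le_of_mul_le_mul_left ?_ hc
    calc _ = (S.card * x) ^ 2 := by ring
      _ ≤ _ := h4

/-- Pigeonhole over the `|S| ^ 2` entries. The lost factor `|S|` does not depend on `k`, so it is
negligible per layer for large `k`. -/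
theorem exists_slabCount_ge (G : SimpleGraph V) {U : Finset V} (l : ℕ) {S : Finset (Finset V)}
    {r : ℕ} (hS : S.Nonempty) (hSU : ∀ R ∈ S, R ⊆ U) (hSr : ∀ R ∈ S, R.card = r) (k : ℕ) :
    ∃ A ∈ S, ∃ B ∈ S,
      ((∑ A ∈ S, ∑ B ∈ S, (layerCount G U l A B : ℝ)) / S.card) ^ 2 ^ k ≤
        S.card * slabCount G U (2 ^ k) (2 ^ k * l + (2 ^ k - 1) * r) A B := by
  have hc : (0 : ℝ) < S.card := by exact_mod_cast hS.card_pos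
  by_contra! hcon
  have h := sum_transferPow_ge G U l S hS k
  set x := ((∑ A ∈ S, ∑ B ∈ S, (layerCount G U l A B : ℝ)) / S.card) ^ 2 ^ k
  have h1 : ∑ A ∈ S, ∑ B ∈ S, (transferPow G U l S k A B : ℝ) < ∑ A ∈ S, ∑ B ∈ S, x / S.card := by
    refine Finset.sum_lt_sum_of_nonempty hS fun A hA =>
      Finset.sum_lt_sum_of_nonempty hS fun B hB => ?_
    rw [lt_div_iff₀ hc, mul_comm]
    refine lt_of_le_of_lt ?_ (hcon A hA B hB)
    gcongr
    exact transferPow_le G l hSU hSr k A B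
  simp only [Finset.sum_const, nsmul_eq_mul] at h1
  rw [mul_div_cancel₀ _ hc.ne'] at h1
  exact absurd h (not_le.2 h1)

end Transfer

/-! ### Entry sums of the transfer matrix, colour classes, and caps. -/

section Layers

variable {V : Type*}

/-- The subsets of `U` with `s` points in each colour class. -/
def balanced (P : V → Prop) [DecidablePred P] (U : Finset V) (s : ℕ) : Finset (Finset V) :=
  (U.powersetCard (2 * s)).filter fun R => (R.filter P).card = s

variable {P : V → Prop} [DecidablePred P]

theorem card_balanced_le (U : Finset V) (s : ℕ) :
    (balanced P U s).card ≤ U.card.choose (2 * s) := by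
  rw [← Finset.card_powersetCard]
  exact Finset.card_filter_le _ _

theorem mem_balanced {U R : Finset V} {s : ℕ} :
    R ∈ balanced P U s ↔ R ⊆ U ∧ R.card = 2 * s ∧ (R.filter P).card = s := by
  simp [balanced, Finset.mem_powersetCard, and_assoc]

variable [DecidableEq V]

theorem filter_sdiff_eq (A B : Finset V) : (A \ B).filter P = A.filter P \ B.filter P := by
  ext x
  simp only [Finset.mem_filter, Finset.mem_sdiff]
  tauto

/-- Double counting of triples `(M, A, B)` in which the matching and the two crossing sets are
mutually disjoint. -/
theorem card_mul_le_sum_layerCount (G : SimpleGraph V) {U : Finset V} {l c : ℕ}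
    {S : Finset (Finset V)}
    (h : ∀ M ∈ matchings G U l,
      c ≤ ((S ×ˢ S).filter fun p => Disjoint p.1 p.2 ∧ Disjoint (cover M) (p.1 ∪ p.2)).card) :
    (matchings G U l).card * c ≤ ∑ A ∈ S, ∑ B ∈ S, layerCount G U l A B := by
  have h1 : ∀ A B, layerCount G U l A B =
      ∑ M ∈ matchings G U l, if Disjoint A B ∧ Disjoint (cover M) (A ∪ B) then 1 else 0 := by
    intro A B
    rw [layerCount, matchings_sdiff, Finset.card_filter]
    by_cases hd : Disjoint A B <;> simp [hd]
  simp_rw [h1]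
  rw [← Finset.sum_product', Finset.sum_comm, ← smul_eq_mul]
  refine Finset.card_nsmul_le_sum _ _ _ fun M hM => ?_
  rw [← Finset.card_filter]
  exact h M hM

theorem sum_layerCount_powersetCard_ge (G : SimpleGraph V) (U : Finset V) (l r : ℕ) :
    (matchings G U l).card * ((U.card - 2 * l).choose r * (U.card - 2 * l - r).choose r) ≤
      ∑ A ∈ U.powersetCard r, ∑ B ∈ U.powersetCard r, layerCount G U l A B := by
  refine card_mul_le_sum_layerCount G fun M hM => ?_
  have hC : (U \ cover M).card = U.card - 2 * l := by
    rw [Finset.card_sdiff_of_subset (cover_subset hM), card_cover hM]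
  have h1 : (((U \ cover M).powersetCard r).sigma
      fun A => ((U \ cover M) \ A).powersetCard r).card =
      (U.card - 2 * l).choose r * (U.card - 2 * l - r).choose r := by
    rw [Finset.card_sigma, ← hC, ← Finset.card_powersetCard, ← smul_eq_mul]
    refine Finset.sum_const_nat fun A hA => ?_
    obtain ⟨hA1, hA2⟩ := Finset.mem_powersetCard.1 hA
    rw [Finset.card_powersetCard, Finset.card_sdiff_of_subset hA1, hA2]
  rw [← h1]
  refine Finset.card_le_card_of_injOn (fun s => (s.1, s.2)) ?_ ?_
  · rintro ⟨A, B⟩ hs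
    simp only [Finset.mem_coe, Finset.mem_sigma, Finset.mem_powersetCard] at hs
    obtain ⟨⟨hA1, hA2⟩, hB1, hB2⟩ := hs
    have hB1' := hB1.trans Finset.sdiff_subset
    refine Finset.mem_coe.2 (Finset.mem_filter.2 ⟨Finset.mem_product.2
      ⟨Finset.mem_powersetCard.2 ⟨hA1.trans Finset.sdiff_subset, hA2⟩,
        Finset.mem_powersetCard.2 ⟨hB1'.trans Finset.sdiff_subset, hB2⟩⟩, ?_, ?_⟩)
    · exact (Finset.disjoint_of_subset_left hB1 Finset.sdiff_disjoint).symm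
    · exact (Finset.disjoint_of_subset_left (Finset.union_subset hA1 hB1')
        Finset.sdiff_disjoint).symm
  · rintro ⟨A, B⟩ _ ⟨A', B'⟩ _ h
    simp only [Prod.mk.injEq] at h
    obtain ⟨rfl, rfl⟩ := h
    rfl

theorem card_filter_cover_eq {G : SimpleGraph V} {U : Finset V} {l : ℕ} {M : Finset (Sym2 V)}
    (hP : ∀ x y, G.Adj x y → (P x ↔ ¬ P y)) (hM : M ∈ matchings G U l) :
    ((cover M).filter P).card = l := by
  rw [card_filter_cover hM P (c := 1), mul_one]
  intro x y h
  have := hP x y h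
  by_cases hy : P y
  · have hx : ¬ P x := by tauto
    rw [Finset.filter_insert, Finset.filter_singleton]
    simp [hx, hy]
  · have hx : P x := by tauto
    rw [Finset.filter_insert, Finset.filter_singleton]
    simp [hx, hy]

/-- A path with an even number of points has a perfect matching, and each of its edges meets both
colours. -/
theorem card_filter_of_isHamPath {G : SimpleGraph V} {U : Finset V} {f : ℕ → V}
    (hP : ∀ x y, G.Adj x y → (P x ↔ ¬ P y)) (hf : IsHamPath G U f) (hU : Even U.card) :
    (U.filter P).card = U.card / 2 := by
  obtain ⟨M, hM⟩ := hf.matchings_nonempty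
  have : cover M = U := Finset.eq_of_subset_of_card_le (cover_subset hM) (by
    rw [card_cover hM]
    obtain ⟨a, ha⟩ := hU
    omega)
  rw [← card_filter_cover_eq hP hM, this]

/-- A matching with `l` edges leaves `4 * s` points free, `2 * s` of each colour. Any `s` of each
colour form `A`, and the remaining free points form `B`, so nothing in the layer stays uncovered. -/
theorem sum_layerCount_balanced_ge {G : SimpleGraph V} {U : Finset V} {f : ℕ → V} {l s : ℕ}
    (hP : ∀ x y, G.Adj x y → (P x ↔ ¬ P y)) (hf : IsHamPath G U f)
    (hls : 2 * l + 4 * s = U.card) :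
    (matchings G U l).card * ((2 * s).choose s) ^ 2 ≤
      ∑ A ∈ balanced P U s, ∑ B ∈ balanced P U s, layerCount G U l A B := by
  refine card_mul_le_sum_layerCount G fun M hM => ?_
  have hUP := card_filter_of_isHamPath hP hf (even_iff_two_dvd.2 ⟨l + 2 * s, by omega⟩)
  set C := U \ cover M with hCdef
  have hCU : C ⊆ U := Finset.sdiff_subset
  have hC : C.card = 4 * s := by
    rw [hCdef, Finset.card_sdiff_of_subset (cover_subset hM), card_cover hM]
    omega
  have hCP : (C.filter P).card = 2 * s := by
    rw [hCdef, filter_sdiff_eq, Finset.card_sdiff_of_subset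
      (Finset.filter_subset_filter _ (cover_subset hM)), card_filter_cover_eq hP hM, hUP]
    omega
  have hCP' : (C.filter fun x => ¬ P x).card = 2 * s := by
    have := Finset.card_filter_add_card_filter_not (s := C) P
    omega
  have h1 : ((C.filter P).powersetCard s ×ˢ (C.filter fun x => ¬ P x).powersetCard s).card =
      ((2 * s).choose s) ^ 2 := by
    rw [Finset.card_product, Finset.card_powersetCard, Finset.card_powersetCard, hCP, hCP', sq]
  rw [← h1]
  have hfil : ∀ X Y : Finset V, X ⊆ C.filter P → Y ⊆ C.filter (fun x => ¬ P x) →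
      (X ∪ Y).filter P = X ∧ (X ∪ Y).filter (fun x => ¬ P x) = Y := by
    intro X Y hX hY
    have hX' : ∀ x ∈ X, P x := fun x hx => (Finset.mem_filter.1 (hX hx)).2
    have hY' : ∀ x ∈ Y, ¬ P x := fun x hx => (Finset.mem_filter.1 (hY hx)).2
    constructor <;>
    · ext x
      simp only [Finset.mem_filter, Finset.mem_union]
      have := hX' x
      have := hY' x
      tauto
  refine Finset.card_le_card_of_injOn (fun p => (p.1 ∪ p.2, C \ (p.1 ∪ p.2))) ?_ ?_
  · rintro ⟨X, Y⟩ hp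
    simp only [Finset.mem_coe, Finset.mem_product, Finset.mem_powersetCard] at hp
    obtain ⟨⟨hX, hXs⟩, hY, hYs⟩ := hp
    have hXY : X ∪ Y ⊆ C := Finset.union_subset (hX.trans (Finset.filter_subset _ _))
      (hY.trans (Finset.filter_subset _ _))
    obtain ⟨f1, f2⟩ := hfil X Y hX hY
    have hc : (X ∪ Y).card = 2 * s := by
      have := Finset.card_filter_add_card_filter_not (s := X ∪ Y) P
      rw [f1, f2] at this
      omega
    refine Finset.mem_coe.2 (Finset.mem_filter.2 ⟨Finset.mem_product.2
      ⟨mem_balanced.2 ⟨hXY.trans hCU, hc, by rw [f1, hXs]⟩,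
        mem_balanced.2 ⟨Finset.sdiff_subset.trans hCU, ?_, ?_⟩⟩, Finset.disjoint_sdiff, ?_⟩)
    · rw [Finset.card_sdiff_of_subset hXY]
      omega
    · rw [filter_sdiff_eq, Finset.card_sdiff_of_subset (Finset.filter_subset_filter _ hXY), f1]
      omega
    · rw [Finset.union_sdiff_of_subset hXY]
      exact Finset.disjoint_sdiff
  · rintro ⟨X, Y⟩ hp ⟨X', Y'⟩ hp' h
    simp only [Finset.mem_coe, Finset.mem_product, Finset.mem_powersetCard] at hp hp'
    simp only [Prod.mk.injEq] at h
    obtain ⟨f1, f2⟩ := hfil X Y hp.1.1 hp.2.1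
    obtain ⟨g1, g2⟩ := hfil X' Y' hp'.1.1 hp'.2.1
    rw [h.1] at f1 f2
    rw [← f1, ← f2, g1, g2]

theorem IsHamPath.iff_add {G : SimpleGraph V} {U : Finset V} {f : ℕ → V}
    (hf : IsHamPath G U f) (hP : ∀ x y, G.Adj x y → (P x ↔ ¬ P y)) (i d : ℕ) (h : i + d < U.card) :
    P (f (i + d)) ↔ (P (f i) ↔ Even d) := by
  induction d with
  | zero => simp
  | succ d ih =>
    have h1 := hP _ _ (hf.adj (i + d) (by omega))
    have h2 := ih (by omega)
    rw [Nat.even_add_one, ← add_assoc]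
    tauto

/-- Two points of `R` of opposite colour at minimal distance along the path: any point of `R`
between them differs in colour from one of the two and would give a closer pair. Colours alternate
along the path, so the distance is odd. -/
theorem exists_gap {G : SimpleGraph V} {U R : Finset V} {f : ℕ → V} {s : ℕ}
    (hP : ∀ x y, G.Adj x y → (P x ↔ ¬ P y)) (hf : IsHamPath G U f)
    (hR : R ∈ balanced P U (s + 1)) :
    ∃ i e, i + 2 * e + 1 < U.card ∧ f i ∈ R ∧ f (i + 2 * e + 1) ∈ R ∧
      (P (f i) ↔ ¬ P (f (i + 2 * e + 1))) ∧ ∀ j, i < j → j < i + 2 * e + 1 → f j ∉ R := by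
  classical
  obtain ⟨hRU, hRc, hRP⟩ := mem_balanced.1 hR
  have hidx : ∀ x ∈ R, ∃ i < U.card, f i = x := fun x hx => by
    have := hRU hx
    rw [← hf.image_eq] at this
    obtain ⟨i, hi, rfl⟩ := Finset.mem_image.1 this
    exact ⟨i, Finset.mem_range.1 hi, rfl⟩
  obtain ⟨x, hx⟩ : (R.filter P).Nonempty := Finset.card_pos.1 (by omega)
  obtain ⟨y, hy⟩ : (R.filter fun x => ¬ P x).Nonempty := Finset.card_pos.1 (by
    have := Finset.card_filter_add_card_filter_not (s := R) P
    omega)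
  rw [Finset.mem_filter] at hx hy
  obtain ⟨i, hi, rfl⟩ := hidx x hx.1
  obtain ⟨j, hj, rfl⟩ := hidx y hy.1
  have hex : ∃ d, ∃ i, i + d < U.card ∧ f i ∈ R ∧ f (i + d) ∈ R ∧ (P (f i) ↔ ¬ P (f (i + d))) := by
    rcases le_total i j with h | h
    · refine ⟨j - i, i, ?_⟩
      rw [Nat.add_sub_cancel' h]
      exact ⟨hj, hx.1, hy.1, by tauto⟩
    · refine ⟨i - j, j, ?_⟩
      rw [Nat.add_sub_cancel' h]
      exact ⟨hi, hy.1, hx.1, by tauto⟩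
  obtain ⟨a, h1, h2, h3, h4⟩ := Nat.find_spec hex
  have hmin := fun d => Nat.find_min hex (m := d)
  set d := Nat.find hex
  have hodd : ¬ Even d := by
    have := hf.iff_add hP a d h1
    tauto
  obtain ⟨e, he⟩ := Nat.not_even_iff_odd.1 hodd
  rw [he, ← add_assoc] at h1 h3 h4
  refine ⟨a, e, h1, h2, h3, h4, fun k hk1 hk2 hk => ?_⟩
  by_cases hc : P (f a) ↔ ¬ P (f k)
  · refine hmin (k - a) (by omega) ⟨a, ?_⟩
    rw [Nat.add_sub_cancel' hk1.le]
    exact ⟨by omega, h2, hk, hc⟩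
  · refine hmin (a + 2 * e + 1 - k) (by omega) ⟨k, ?_⟩
    rw [Nat.add_sub_cancel' hk2.le]
    exact ⟨h1, hk, h3, by tauto⟩

/-- A slab with a balanced set removed from its last layer has a perfect matching if it is
sufficiently high. -/
theorem exists_cap {G : SimpleGraph V} {U R : Finset V} {f : ℕ → V} {s : ℕ}
    (hP : ∀ x y, G.Adj x y → (P x ↔ ¬ P y)) (hf : IsHamPath G U f) (hU : Even U.card)
    (hR : R ∈ balanced P U s) :
    ∃ L, 2 * L + 2 * s = (2 * s + 1) * U.card ∧ 0 < slabCount G U (2 * s + 1) L ∅ R := by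
  classical
  induction s generalizing R with
  | zero =>
    obtain ⟨hRU, hRc, hRP⟩ := mem_balanced.1 hR
    obtain rfl : R = ∅ := Finset.card_eq_zero.1 (by simpa using hRc)
    refine ⟨U.card / 2, by obtain ⟨a, ha⟩ := hU; omega, ?_⟩
    refine lt_of_lt_of_le ?_ (layerCount_le_slabCount G U _ ∅ ∅)
    simpa [layerCount] using hf.matchings_nonempty
  | succ s ih =>
    obtain ⟨hRU, hRc, hRP⟩ := mem_balanced.1 hR
    obtain ⟨i, e, h1, h2, h3, h4, h5⟩ := exists_gap hP hf hR
    have hinj : ∀ a b, a < U.card → b < U.card → f a = f b → a = b := fun a b ha hb hab =>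
      hf.injOn (by simpa using ha) (by simpa using hb) hab
    have hne : f i ≠ f (i + 2 * e + 1) := fun h => by
      rw [← h] at h4
      tauto
    set gap := (Finset.Ico (i + 1) (i + 1 + 2 * e)).image f with hgap
    set full := (Finset.Ico i (i + 2 * (e + 1))).image f with hfull
    have hfull' : full = insert (f i) (insert (f (i + 2 * e + 1)) gap) := by
      rw [hfull, hgap, ← Finset.image_insert, ← Finset.image_insert]
      congr 1
      ext a
      simp only [Finset.mem_Ico, Finset.mem_insert]
      omega
    have hgapU : gap ⊆ U := fun x hx => by
      obtain ⟨a, ha, rfl⟩ := Finset.mem_image.1 hx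
      rw [Finset.mem_Ico] at ha
      exact hf.mem (by omega)
    have hgapR : Disjoint R gap := Finset.disjoint_right.2 fun x hx => by
      obtain ⟨a, ha, rfl⟩ := Finset.mem_image.1 hx
      rw [Finset.mem_Ico] at ha
      exact h5 a (by omega) (by omega)
    have hgapc : gap.card = 2 * e := by
      rw [hgap, Finset.card_image_of_injOn, Nat.card_Ico]
      · omega
      · intro a ha b hb
        simp only [Finset.coe_Ico, Set.mem_Ico] at ha hb
        exact hinj a b (by omega) (by omega)
    -- Two layers are put on a cap for `R₂`, which is `R` without the pair. The lower one has
    -- crossing sets `R₂` and `R₁`, leaving the segment `full` of `2 * (e + 1)` path points; the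
    -- upper one has `R₁` and `R`, leaving `gap` with `2 * e` points. Both segments are matched
    -- along the path.
    set R₁ := U \ (R ∪ gap) with hR₁
    set R₂ := R \ {f i, f (i + 2 * e + 1)} with hR₂
    have hpair : ({f i, f (i + 2 * e + 1)} : Finset V) ⊆ R := by
      intro x hx
      simp only [Finset.mem_insert, Finset.mem_singleton] at hx
      rcases hx with rfl | rfl <;> assumption
    have hR₂c : R₂.card = 2 * s := by
      rw [hR₂, Finset.card_sdiff_of_subset hpair, Finset.card_pair hne]
      omega
    have hR₂P : (R₂.filter P).card = s := by
      rw [hR₂, filter_sdiff_eq, Finset.card_sdiff_of_subset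
        (Finset.filter_subset_filter _ hpair), hRP]
      have : (({f i, f (i + 2 * e + 1)} : Finset V).filter P).card = 1 := by
        by_cases hy : P (f i)
        · have hx : ¬ P (f (i + 2 * e + 1)) := by tauto
          rw [Finset.filter_insert, Finset.filter_singleton]
          simp [hx, hy]
        · have hx : P (f (i + 2 * e + 1)) := by tauto
          rw [Finset.filter_insert, Finset.filter_singleton]
          simp [hx, hy]
      omega
    have hR₁c : R₁.card + 2 * (s + 1) + 2 * e = U.card := by
      rw [hR₁, Finset.card_sdiff_of_subset (Finset.union_subset hRU hgapU),
        Finset.card_union_of_disjoint hgapR, hRc, hgapc]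
      have := Finset.card_le_card (Finset.union_subset hRU hgapU)
      rw [Finset.card_union_of_disjoint hgapR, hRc, hgapc] at this
      omega
    have hR₂U : R₂ ⊆ U := Finset.sdiff_subset.trans hRU
    obtain ⟨L, hL, hpos⟩ := ih (mem_balanced.2 ⟨hR₂U, hR₂c, hR₂P⟩)
    have hs1 : U \ (R₂ ∪ R₁) = full := by
      rw [hfull']
      ext x
      simp only [hR₁, hR₂, Finset.mem_sdiff, Finset.mem_union, Finset.mem_insert,
        Finset.mem_singleton]
      constructor
      · rintro ⟨hxU, hn⟩
        by_contra hc
        by_cases hxR : x ∈ R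
        · exact hn (Or.inl ⟨hxR, fun h => hc (h.elim Or.inl fun h => Or.inr (Or.inl h))⟩)
        · exact hn (Or.inr ⟨hxU, fun h => h.elim hxR fun h => hc (Or.inr (Or.inr h))⟩)
      · rintro (rfl | rfl | hx)
        · exact ⟨hRU h2, fun h => h.elim (fun h => h.2 (Or.inl rfl)) fun h => h.2 (Or.inl h2)⟩
        · exact ⟨hRU h3, fun h => h.elim (fun h => h.2 (Or.inr rfl)) fun h => h.2 (Or.inl h3)⟩
        · exact ⟨hgapU hx, fun h => h.elim (fun h => Finset.disjoint_left.1 hgapR h.1 hx)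
            fun h => h.2 (Or.inr hx)⟩
    have hs2 : U \ (R₁ ∪ R) = gap := by
      ext x
      simp only [hR₁, Finset.mem_sdiff, Finset.mem_union]
      constructor
      · rintro ⟨hxU, hn⟩
        by_contra hc
        exact hn (Or.inl ⟨hxU, fun h => h.elim (fun h => hn (Or.inr h)) hc⟩)
      · exact fun hx => ⟨hgapU hx, fun h => h.elim (fun h => h.2 (Or.inr hx))
          fun h => Finset.disjoint_left.1 hgapR h hx⟩
    have hd1 : Disjoint R₂ R₁ := Finset.disjoint_left.2 fun x hx hx' =>
      (Finset.mem_sdiff.1 hx').2 (Finset.mem_union_left _ (Finset.mem_sdiff.1 hx).1)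
    have hd2 : Disjoint R₁ R := Finset.disjoint_left.2 fun x hx hx' =>
      (Finset.mem_sdiff.1 hx).2 (Finset.mem_union_left _ hx')
    have p1 : 0 < slabCount G U 1 (e + 1) R₂ R₁ := by
      refine lt_of_lt_of_le ?_ (layerCount_le_slabCount G U _ _ _)
      rw [layerCount, if_pos hd1, hs1]
      exact Finset.card_pos.2 (hf.matchings_segment_nonempty i (e + 1) (by omega))
    have p2 : 0 < slabCount G U 1 e R₁ R := by
      refine lt_of_lt_of_le ?_ (layerCount_le_slabCount G U _ _ _)
      rw [layerCount, if_pos hd2, hs2]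
      exact Finset.card_pos.2 (hf.matchings_segment_nonempty (i + 1) e (by omega))
    have q1 := (Nat.mul_pos hpos p1).trans_le
      (slabCount_mul_le G hR₂U (by omega) one_pos L (e + 1) ∅ R₁)
    have q2 := (Nat.mul_pos q1 p2).trans_le
      (slabCount_mul_le G (Finset.sdiff_subset : R₁ ⊆ U) (by omega) one_pos _ e ∅ R)
    refine ⟨_, ?_, q2⟩
    rw [hR₂c, ← hR₁]
    have : (2 * (s + 1) + 1) * U.card = (2 * s + 1) * U.card + 2 * U.card := by ring
    omega

end Layers

/-! ### Boxes built from stacked layers. -/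

section Blocks

theorem slabCount_le_boxCount {d : ℕ} (m : Fin d → ℕ) (n l : ℕ) (A B : Finset (Fin d → ℕ)) :
    slabCount (lattice d) (boxPts m) n l A B ≤
      boxCount (Fin.cons n m : Fin (d + 1) → ℕ) l := by
  refine (slabCount_le _ _ _ _ _ _).trans ?_
  refine card_matchings_le_of_map _ _ (fun a => (Fin.cons a.1 a.2 : Fin (d + 1) → ℕ)) ?_ ?_ ?_ _
  · intro a _ b _ h
    obtain ⟨h1, h2⟩ := Fin.cons_inj.1 h
    exact Prod.ext h1 h2
  · intro a ha
    exact cons_mem_boxPts.2 (mem_slab.1 ha).1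
  · intro a _ b _ h
    rw [lattice_adj_cons]
    rcases h with ⟨h1, h2⟩ | ⟨h1, h2⟩
    · rw [lattice_adj] at h2
      simp [h1, h2]
    · simp only [h1, sub_self, abs_zero, Finset.sum_const_zero, add_zero]
      rcases h2 with h2 | h2
      · rw [← h2]
        simp
      · rw [← h2]
        simp

theorem even_sum_iff_of_adj {d : ℕ} (x y : Fin d → ℕ) (h : (lattice d).Adj x y) :
    Even (∑ k, x k) ↔ ¬ Even (∑ k, y k) := by
  obtain ⟨k, h | h⟩ := exists_single_of_adj h
  · rw [h]
    simp [Finset.sum_add_distrib, Nat.even_add_one]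
  · rw [h]
    simp [Finset.sum_add_distrib, Nat.even_add_one]

/-- Delete dimers from a tiling with at most one monomer. -/
theorem boxCount_pos {d : ℕ} {m : Fin d → ℕ} {l : ℕ} (h : 2 * l ≤ boxSize m) :
    0 < boxCount m l := by
  have h1 := boxCount_half_pos m
  have h2 := boxCount_add_le m l (boxSize m / 2 - l)
  rw [Nat.add_sub_cancel' (by omega)] at h2
  exact Nat.pos_of_mul_pos_right (h1.trans_le h2)

/-- Stacking `2 ^ k` layers, joined by `r` vertical dimers each. -/
theorem pow_le_boxCount_cons {d : ℕ} (m : Fin d → ℕ) {l r : ℕ} (hr : r ≤ boxSize m) (k : ℕ) :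
    ((boxCount m l : ℝ) * ((boxSize m - 2 * l).choose r * (boxSize m - 2 * l - r).choose r :) /
        (boxSize m).choose r) ^ 2 ^ k ≤
      (boxSize m).choose r *
        boxCount (Fin.cons (2 ^ k) m : Fin (d + 1) → ℕ) (2 ^ k * l + (2 ^ k - 1) * r) := by
  have hne : ((boxPts m).powersetCard r).Nonempty :=
    Finset.powersetCard_nonempty.2 (by rwa [card_boxPts])
  obtain ⟨A, hA, B, hB, h⟩ := exists_slabCount_ge (lattice d) l hne
    (fun R hR => (Finset.mem_powersetCard.1 hR).1) (fun R hR => (Finset.mem_powersetCard.1 hR).2) k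
  have h1 := sum_layerCount_powersetCard_ge (lattice d) (boxPts m) l r
  rw [Finset.card_powersetCard] at h
  rw [card_boxPts] at h h1
  refine le_trans ?_ (h.trans ?_)
  · gcongr
    exact_mod_cast h1
  · gcongr
    exact slabCount_le_boxCount m _ _ A B

/-- The same with perfect matchings: the bottom and the top are closed by caps. -/
theorem pow_le_boxCount_cons_perfect {d : ℕ} (m : Fin d → ℕ) {l s : ℕ}
    (hls : 2 * l + 4 * s = boxSize m) (k : ℕ) :
    ∃ L, 2 * L = (2 ^ k + 4 * s + 2) * boxSize m ∧
    ((boxCount m l : ℝ) * ((2 * s).choose s ^ 2 :) / (boxSize m).choose (2 * s)) ^ 2 ^ k ≤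
      (boxSize m).choose (2 * s) * boxCount (Fin.cons (2 ^ k + 4 * s + 2) m : Fin (d + 1) → ℕ) L := by
  classical
  obtain ⟨f, hf⟩ := exists_isHamPath m
  have hP := even_sum_iff_of_adj (d := d)
  set P : (Fin d → ℕ) → Prop := fun x => Even (∑ k, x k) with hPdef
  have h1 := sum_layerCount_balanced_ge (P := P) (l := l) (s := s) hP hf (by rw [card_boxPts, hls])
  have hpos : 0 < boxCount m l := boxCount_pos (by omega)
  have hne : (balanced P (boxPts m) s).Nonempty := by
    by_contra h
    rw [Finset.not_nonempty_iff_eq_empty] at h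
    rw [h] at h1
    simp only [Finset.sum_empty, nonpos_iff_eq_zero, mul_eq_zero, pow_eq_zero_iff, ne_eq,
      OfNat.ofNat_ne_zero, not_false_eq_true] at h1
    rcases h1 with h1 | h1
    · exact hpos.ne' h1
    · exact (Nat.choose_pos (by omega)).ne' h1
  obtain ⟨A, hA, B, hB, h⟩ := exists_slabCount_ge (lattice d) l hne
    (fun R hR => (mem_balanced.1 hR).1) (fun R hR => (mem_balanced.1 hR).2.1) k
  have hev : Even (boxPts m).card := by
    rw [card_boxPts, ← hls]
    exact even_iff_two_dvd.2 ⟨l + 2 * s, by omega⟩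
  obtain ⟨L₁, e1, p1⟩ := exists_cap hP hf hev hA
  obtain ⟨L₂, e2, p2⟩ := exists_cap hP hf hev hB
  -- The cap for `B` is turned upside down. Two caps of height `2 * s + 1` then enclose the `2 ^ k`
  -- layers, whence the height `2 ^ k + 4 * s + 2`.
  have p2 := p2.trans_le (slabCount_comm _ _ _ _ _ _)
  obtain ⟨hAU, hAc, -⟩ := mem_balanced.1 hA
  obtain ⟨hBU, hBc, -⟩ := mem_balanced.1 hB
  have hk : 0 < 2 ^ k := by positivity
  set Lm := 2 ^ k * l + (2 ^ k - 1) * (2 * s) with hLm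
  have q1 := slabCount_mul_le (lattice d) hAU (by omega : 0 < 2 * s + 1) hk L₁ Lm ∅ B
  have q2 := slabCount_mul_le (lattice d) hBU (by omega : 0 < 2 * s + 1 + 2 ^ k)
    (by omega : 0 < 2 * s + 1) (L₁ + Lm + A.card) L₂ ∅ ∅
  have q3 := ((Nat.le_mul_of_pos_left _ p1).trans q1).trans
    ((Nat.le_mul_of_pos_right _ p2).trans q2)
  rw [show 2 * s + 1 + 2 ^ k + (2 * s + 1) = 2 ^ k + 4 * s + 2 by omega] at q3
  have q4 := q3.trans (slabCount_le_boxCount m _ _ ∅ ∅)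
  refine ⟨L₁ + Lm + A.card + L₂ + B.card, ?_, le_trans ?_ (h.trans ?_)⟩
  · rw [hAc, hBc]
    rw [card_boxPts, ← hls] at e1 e2
    rw [← hls]
    obtain ⟨a, ha⟩ : ∃ a, 2 ^ k = a + 1 := ⟨2 ^ k - 1, by omega⟩
    rw [ha, Nat.add_sub_cancel] at hLm
    rw [ha]
    zify at e1 e2 hLm ⊢
    linear_combination 2 * hLm + e1 + e2
  · have hc : (0 : ℝ) < (balanced P (boxPts m) s).card := by exact_mod_cast hne.card_pos
    have hle : ((balanced P (boxPts m) s).card : ℝ) ≤ (boxSize m).choose (2 * s) := by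
      rw [← card_boxPts]
      exact_mod_cast card_balanced_le _ _
    gcongr
    exact_mod_cast h1
  · have hle : ((balanced P (boxPts m) s).card : ℝ) ≤ (boxSize m).choose (2 * s) := by
      rw [← card_boxPts]
      exact_mod_cast card_balanced_le _ _
    gcongr

end Blocks

/-! ### Stirling estimates and logarithmic form of the block bounds. -/

section Logs

open Real

theorem le_log_factorial (n : ℕ) : n * log n - n ≤ log n.factorial := by
  rcases eq_or_ne n 0 with rfl | hn
  · simp
  have h := Stirling.le_log_factorial_stirling hn
  have h1 : 0 ≤ log n := log_natCast_nonneg n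
  have h2 : 0 ≤ log (2 * π) := log_nonneg (by linarith [pi_gt_three])
  linarith

theorem log_factorial_le (n : ℕ) : log n.factorial ≤ n * log n - n + log n + 1 := by
  rcases Nat.eq_zero_or_pos n with rfl | hn
  · simp
  induction n, hn using Nat.le_induction with
  | base => simp
  | succ n hn ih =>
    have hn' : (0 : ℝ) < n := by exact_mod_cast hn
    rw [Nat.factorial_succ, Nat.cast_mul, log_mul (by positivity) (by positivity)]
    have h := one_sub_inv_le_log_of_pos (x := ((n : ℝ) + 1) / n) (by positivity)
    rw [log_div (by positivity) (by positivity), inv_div] at h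
    have h1 : 1 ≤ ((n : ℝ) + 1) * (log (n + 1) - log n) := by
      calc (1 : ℝ) = (n + 1) * (1 - n / (n + 1)) := by
            field_simp
            ring
        _ ≤ _ := by gcongr
    push_cast
    linarith

/-- The exponential rate of the multinomial weight in the bound. -/
def rate (x r : ℝ) : ℝ :=
  x * log x - r * log r - (x - 2 * r) * log (x - 2 * r) + (1 - r) * log (1 - r)

theorem continuous_rate : Continuous fun p : ℝ × ℝ => rate p.1 p.2 := by
  have h := continuous_mul_log
  unfold rate
  exact (((h.comp continuous_fst).sub (h.comp continuous_snd)).sub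
    (h.comp (by fun_prop : Continuous fun p : ℝ × ℝ => p.1 - 2 * p.2))).add
    (h.comp (by fun_prop : Continuous fun p : ℝ × ℝ => 1 - p.2))

theorem log_choose {n k : ℕ} (h : k ≤ n) :
    log (n.choose k) = log n.factorial - log k.factorial - log (n - k).factorial := by
  rw [← Nat.choose_mul_factorial_mul_factorial h]
  have := Nat.choose_pos h
  push_cast
  rw [log_mul (by positivity) (by positivity), log_mul (by positivity) (by positivity)]
  ring

/-- The left-over factorials are `M! (N-r)! / (r! (M-2r)! N!)`, whose linear Stirling terms cancel.
Each of the three factorials in the denominator costs an error of at most `log N + 1`. -/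
theorem rate_le_log_choose {N M r : ℕ} (hN : 0 < N) (hM : M ≤ N) (hr : 2 * r ≤ M) :
    N * rate (M / N) (r / N) - 3 * (log N + 1) ≤
      log (M.choose r) + log ((M - r).choose r) - log (N.choose r) := by
  rw [log_choose (by omega), log_choose (by omega), log_choose (by omega)]
  have hN' : (0 : ℝ) < N := by exact_mod_cast hN
  have key : ∀ n : ℕ, n ≤ N → (N : ℝ) * ((n / N : ℝ) * log (n / N)) = n * log n - n * log N := by
    intro n _
    rcases Nat.eq_zero_or_pos n with rfl | hn
    · simp
    · rw [log_div (by positivity) (by positivity)]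
      field_simp
  have e1 := key M hM
  have e2 := key r (by omega)
  have e3 := key (M - 2 * r) (by omega)
  have e4 := key (N - r) (by omega)
  have s1 := le_log_factorial M
  have s2 := log_factorial_le r
  have s3 := log_factorial_le (M - 2 * r)
  have s4 := le_log_factorial (N - r)
  have s5 := log_factorial_le N
  rw [show M - r - r = M - 2 * r by omega]
  have c1 : ((M - 2 * r : ℕ) : ℝ) = M - 2 * r := by push_cast [hr]; ring
  have c2 : ((N - r : ℕ) : ℝ) = N - r := by rw [Nat.cast_sub (by omega)]
  have mono : ∀ n : ℕ, n ≤ N → log n ≤ log N := by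
    intro n hn
    rcases Nat.eq_zero_or_pos n with rfl | hn0
    · simpa using log_natCast_nonneg N
    · exact log_le_log (by exact_mod_cast hn0) (by exact_mod_cast hn)
  have m2 := mono r (by omega)
  have m3 := mono (M - 2 * r) (by omega)
  rw [c1] at e3 s3 m3
  rw [c2] at e4 s4
  have d3 : ((M : ℝ) - 2 * r) / N = M / N - 2 * (r / N) := by ring
  have d4 : ((N : ℝ) - r) / N = 1 - r / N := by field_simp
  rw [d3] at e3
  rw [d4] at e4
  have : (N : ℝ) * rate (M / N) (r / N) =
      M * log M - r * log r - (M - 2 * r) * log (M - 2 * r) + (N - r) * log (N - r) - N * log N := by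
    unfold rate
    linear_combination e1 - e2 - e3 + e4
  rw [this]
  linarith

theorem log_choose_le {N r : ℕ} (h : r ≤ N) : log (N.choose r) ≤ N * log 2 := by
  rw [← log_pow]
  exact log_le_log (by exact_mod_cast Nat.choose_pos h) (by exact_mod_cast Nat.choose_le_two_pow N r)

theorem log_boxCount_cons_ge {d : ℕ} (m : Fin d → ℕ) {l r : ℕ} (hN : 0 < boxSize m)
    (h : 2 * l + 2 * r ≤ boxSize m) (k : ℕ) :
    2 ^ k * (log (boxCount m l) + boxSize m *
        rate (1 - 2 * l / boxSize m) (r / boxSize m) - 3 * (log (boxSize m) + 1)) ≤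
      boxSize m * log 2 +
        log (boxCount (Fin.cons (2 ^ k) m : Fin (d + 1) → ℕ) (2 ^ k * l + (2 ^ k - 1) * r)) := by
  have h1 := pow_le_boxCount_cons m (l := l) (r := r) (by omega) k
  have h2 := rate_le_log_choose hN (M := boxSize m - 2 * l) (r := r) (by omega) (by omega)
  have hp0 : (0 : ℝ) < boxCount m l := by exact_mod_cast boxCount_pos (by omega)
  have hp1 : (0 : ℝ) < (boxSize m - 2 * l).choose r := by
    exact_mod_cast Nat.choose_pos (by omega)
  have hp2 : (0 : ℝ) < (boxSize m - 2 * l - r).choose r := by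
    exact_mod_cast Nat.choose_pos (by omega)
  have hp3 : (0 : ℝ) < (boxSize m).choose r := by exact_mod_cast Nat.choose_pos (by omega)
  have hN' : (boxSize m : ℝ) ≠ 0 := by positivity
  have hM : ((boxSize m - 2 * l : ℕ) : ℝ) / boxSize m = 1 - 2 * l / boxSize m := by
    rw [Nat.cast_sub (by omega), sub_div, div_self hN']
    push_cast
    ring
  rw [hM] at h2
  push_cast at h1
  have hlhs : (0 : ℝ) < ((boxCount m l : ℝ) * (((boxSize m - 2 * l).choose r : ℝ) *
      (boxSize m - 2 * l - r).choose r) / (boxSize m).choose r) ^ 2 ^ k := by positivity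
  have hp4 := pos_of_mul_pos_right (hlhs.trans_le h1) hp3.le
  have h3 := log_le_log hlhs h1
  rw [log_pow, log_div (by positivity) (by positivity), log_mul (by positivity) (by positivity),
    log_mul (by positivity) (by positivity), log_mul hp3.ne' hp4.ne'] at h3
  have h4 := log_choose_le (N := boxSize m) (r := r) (by omega)
  push_cast at h3
  have h5 : (2 : ℝ) ^ k * (log (boxCount m l) + boxSize m *
      rate (1 - 2 * l / boxSize m) (r / boxSize m) - 3 * (log (boxSize m) + 1)) ≤ 2 ^ k *
      (log (boxCount m l) + (log ((boxSize m - 2 * l).choose r) +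
        log ((boxSize m - 2 * l - r).choose r)) - log ((boxSize m).choose r)) := by
    refine mul_le_mul_of_nonneg_left ?_ (by positivity)
    linarith
  linarith

theorem log_boxCount_cons_perfect_ge {d : ℕ} (m : Fin d → ℕ) {l s : ℕ} (hN : 0 < boxSize m)
    (h : 2 * l + 4 * s = boxSize m) (k : ℕ) :
    ∃ L, 2 * L = (2 ^ k + 4 * s + 2) * boxSize m ∧
    2 ^ k * (log (boxCount m l) + boxSize m *
        rate (1 - 2 * l / boxSize m) ((2 * s : ℕ) / boxSize m) - 5 * (log (boxSize m) + 1)) ≤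
      boxSize m * log 2 +
        log (boxCount (Fin.cons (2 ^ k + 4 * s + 2) m : Fin (d + 1) → ℕ) L) := by
  obtain ⟨L, hL, h1⟩ := pow_le_boxCount_cons_perfect m h k
  refine ⟨L, hL, ?_⟩
  have h2 := rate_le_log_choose hN (M := boxSize m - 2 * l) (r := 2 * s) (by omega) (by omega)
  have hp0 : (0 : ℝ) < boxCount m l := by exact_mod_cast boxCount_pos (by omega)
  have hp1 : (0 : ℝ) < (2 * s).choose s := by exact_mod_cast Nat.choose_pos (by omega)
  have hp3 : (0 : ℝ) < (boxSize m).choose (2 * s) := by exact_mod_cast Nat.choose_pos (by omega)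
  have hN' : (boxSize m : ℝ) ≠ 0 := by positivity
  have hM : ((boxSize m - 2 * l : ℕ) : ℝ) / boxSize m = 1 - 2 * l / boxSize m := by
    rw [Nat.cast_sub (by omega), sub_div, div_self hN']
    push_cast
    ring
  rw [hM, show boxSize m - 2 * l = 4 * s by omega, show 4 * s - 2 * s = 2 * s by omega,
    Nat.choose_self, Nat.cast_one, log_one, add_zero] at h2
  push_cast at h1
  have hlhs : (0 : ℝ) < ((boxCount m l : ℝ) * ((2 * s).choose s : ℝ) ^ 2 /
      (boxSize m).choose (2 * s)) ^ 2 ^ k := by positivity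
  have hp4 := pos_of_mul_pos_right (hlhs.trans_le h1) hp3.le
  have h3 := log_le_log hlhs h1
  rw [log_pow, log_div (by positivity) (by positivity), log_mul (by positivity) (by positivity),
    log_mul hp3.ne' hp4.ne'] at h3
  have h4 := log_choose_le (N := boxSize m) (r := 2 * s) (by omega)
  -- Demanding equal colours costs only a polynomial factor: `C(4s,2s) ≤ 16 ^ s ≤ ((2s+1) C(2s,s)) ^
  -- 2`. This raises the error constant from `3` to `5`.
  have h6 : log ((4 * s).choose (2 * s)) ≤ log (((2 * s).choose s : ℝ) ^ 2) +
      2 * (log (boxSize m) + 1) := by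
    have hc : (4 * s).choose (2 * s) ≤ ((2 * s + 1) * (2 * s).choose s) ^ 2 := by
      refine (Nat.choose_le_two_pow _ _).trans ?_
      have := Nat.four_pow_le_two_mul_add_one_mul_central_binom s
      calc 2 ^ (4 * s) = (4 ^ s) ^ 2 := by
            rw [← pow_mul, show (4 : ℕ) = 2 ^ 2 by rfl, ← pow_mul]
            ring_nf
        _ ≤ _ := Nat.pow_le_pow_left this 2
    have hlog : log (2 * s + 1 : ℝ) ≤ log (boxSize m) + 1 := by
      have : (2 * s + 1 : ℝ) ≤ boxSize m * exp 1 := by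
        have e1 : (2 : ℝ) ≤ exp 1 := by linarith [add_one_le_exp (1 : ℝ)]
        have e2 : (2 * s + 1 : ℝ) ≤ boxSize m * 2 := by
          exact_mod_cast (by omega : 2 * s + 1 ≤ boxSize m * 2)
        nlinarith [show (0 : ℝ) ≤ boxSize m by positivity]
      calc _ ≤ log (boxSize m * exp 1) := log_le_log (by positivity) this
        _ = _ := by rw [log_mul hN' (exp_pos 1).ne', log_exp]
    have hc' := log_le_log (by exact_mod_cast Nat.choose_pos (by omega))
      (by exact_mod_cast hc : ((4 * s).choose (2 * s) : ℝ) ≤ ((2 * s + 1) * (2 * s).choose s) ^ 2)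
    rw [mul_pow, log_mul (by positivity) (by positivity), log_pow] at hc'
    push_cast at hc'
    linarith
  push_cast at h3 h2 ⊢
  have h5 : (2 : ℝ) ^ k * (log (boxCount m l) + boxSize m *
      rate (1 - 2 * l / boxSize m) (2 * s / boxSize m) - 5 * (log (boxSize m) + 1)) ≤ 2 ^ k *
      (log (boxCount m l) + log (((2 * s).choose s : ℝ) ^ 2) -
        log ((boxSize m).choose (2 * s))) := by
    refine mul_le_mul_of_nonneg_left ?_ (by positivity)
    linarith
  linarith

end Logs

/-! ### Limits along `densityFilter`, and the passage from one block to all large boxes. -/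

section Limits

variable {d : ℕ} {p : ℝ}

theorem tendsto_side (k : Fin d) : Tendsto (fun s => s.1 k) (densityFilter d p) atTop := by
  have h : Tendsto (fun s : (Fin d → ℕ) × ℕ => s.1) (densityFilter d p) atTop :=
    tendsto_comap.mono_left (inf_le_left.trans inf_le_left)
  refine tendsto_atTop.2 fun b => ?_
  filter_upwards [tendsto_atTop.1 h fun _ => b] with s hs using hs k

theorem tendsto_density :
    Tendsto (fun s => 2 * (s.2 : ℝ) / (boxSize s.1 : ℝ)) (densityFilter d p) (𝓝 p) :=
  tendsto_comap.mono_left (inf_le_left.trans inf_le_right)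

theorem eventually_two_mul_le : ∀ᶠ s in densityFilter d p, 2 * s.2 ≤ boxSize s.1 :=
  (inf_le_right : densityFilter d p ≤ _) (mem_principal_self _)

theorem eventually_pos : ∀ᶠ s in densityFilter d p, ∀ k, 0 < s.1 k :=
  eventually_all.2 fun k => (tendsto_side k).eventually_gt_atTop 0

theorem boxSize_pos {m : Fin d → ℕ} (h : ∀ k, 0 < m k) : 0 < boxSize m :=
  Finset.prod_pos fun k _ => h k

theorem tendsto_boxSize (hd : 1 ≤ d) :
    Tendsto (fun s => (boxSize s.1 : ℝ)) (densityFilter d p) atTop := by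
  refine tendsto_natCast_atTop_atTop.comp ?_
  refine tendsto_atTop_mono' _ ?_ (tendsto_side (p := p) (⟨0, hd⟩ : Fin d))
  filter_upwards [eventually_pos] with s hs
  exact Nat.le_of_dvd (boxSize_pos hs) (Finset.dvd_prod_of_mem _ (Finset.mem_univ _))

theorem logCount_eq {s : (Fin d → ℕ) × ℕ} (h : ∀ k, 0 < s.1 k) :
    logCount s = Real.log (boxCount s.1 s.2) / boxSize s.1 := by
  rw [logCount, ncard_tilings h]

theorem logCount_nonneg (s : (Fin d → ℕ) × ℕ) : 0 ≤ logCount s :=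
  div_nonneg (Real.log_natCast_nonneg _) (Nat.cast_nonneg _)

/-- Real-valued `liminf` and `limsup` are meaningful only under boundedness, which this and
`logCount_nonneg` supply. -/
theorem eventually_logCount_le : ∀ᶠ s in densityFilter d p, logCount s ≤ d * Real.log 2 := by
  filter_upwards [eventually_pos, eventually_two_mul_le] with s hs hl
  have hN : (0 : ℝ) < boxSize s.1 := by exact_mod_cast boxSize_pos hs
  rw [logCount_eq hs, div_le_iff₀ hN]
  have h := Real.log_le_log (by exact_mod_cast boxCount_pos hl)
    (by exact_mod_cast boxCount_le s.1 s.2 :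
      (boxCount s.1 s.2 : ℝ) ≤ (2 : ℝ) ^ (d * boxSize s.1))
  rw [Real.log_pow] at h
  push_cast at h
  linarith

theorem tendsto_mul_div_self {c : ℕ} (hc : 0 < c) :
    Tendsto (fun m : ℕ => ((c * (m / c) : ℕ) : ℝ) / m) atTop (𝓝 1) := by
  have h1 : Tendsto (fun m : ℕ => 1 - (c : ℝ) / m) atTop (𝓝 1) := by
    simpa using (tendsto_const_nhds (x := (1 : ℝ))).sub
      (tendsto_const_div_atTop_nhds_zero_nat (c : ℝ))
  refine tendsto_of_tendsto_of_tendsto_of_le_of_le' h1 tendsto_const_nhds ?_ ?_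
  · filter_upwards [eventually_gt_atTop 0] with m hm
    have hm' : (0 : ℝ) < m := by exact_mod_cast hm
    rw [sub_le_iff_le_add, ← add_div, le_div_iff₀ hm', one_mul]
    have := Nat.div_add_mod m c
    have := Nat.mod_lt m hc
    exact_mod_cast (by omega : m ≤ c * (m / c) + c)
  · filter_upwards [eventually_gt_atTop 0] with m hm
    have hm' : (0 : ℝ) < m := by exact_mod_cast hm
    rw [div_le_one hm']
    exact_mod_cast Nat.mul_div_le m c

/-- From `C(E,j) x ^ j ≤ (1 + x) ^ E ≤ exp (E x)`. For small `x` and `j` much smaller still,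
deleting `j` of `E` edges costs little entropy. -/
theorem log_choose_le_of_pos (E j : ℕ) (hj : j ≤ E) {x : ℝ} (hx : 0 < x) :
    Real.log (E.choose j) ≤ E * x - j * Real.log x := by
  have h1 : (E.choose j : ℝ) * x ^ j ≤ Real.exp x ^ E := by
    calc (E.choose j : ℝ) * x ^ j = x ^ j * 1 ^ (E - j) * E.choose j := by
          rw [one_pow]
          ring
      _ ≤ (x + 1) ^ E := by
          rw [add_pow]
          exact Finset.single_le_sum (f := fun i => x ^ i * 1 ^ (E - i) * (E.choose i : ℝ))
            (fun i _ => by positivity) (Finset.mem_range.2 (by omega))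
      _ ≤ _ := by
          gcongr
          exact Real.add_one_le_exp x
  have hc : (0 : ℝ) < E.choose j := by exact_mod_cast Nat.choose_pos hj
  have h2 := Real.log_le_log (by positivity) h1
  rw [Real.log_mul hc.ne' (by positivity), Real.log_pow, Real.log_pow, Real.log_exp] at h2
  linarith

/-- Copies of one tiled block fill up every large box, with few dimers to be removed. -/
theorem le_lowerEntropy (hd : 1 ≤ d) (hp : p ∈ Set.Icc (0 : ℝ) 1) {X : ℝ}
    (h : ∀ ε > 0, ∀ δ > 0, ∃ (b : Fin d → ℕ) (L : ℕ), (∀ k, 0 < b k) ∧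
      (p * boxSize b < 2 * L ∨ 2 * L = boxSize b) ∧ 2 * L ≤ boxSize b ∧
      2 * L ≤ (p + δ) * boxSize b ∧
      (X - ε) * boxSize b ≤ Real.log (boxCount b L)) :
    X ≤ lowerEntropy d p := by
  have hne := densityFilter_neBot hd hp
  have hcob : IsCoboundedUnder (· ≥ ·) (densityFilter d p) logCount :=
    (isBoundedUnder_of_eventually_le eventually_logCount_le).isCoboundedUnder_ge
  refine le_of_forall_pos_le_add fun ε hε => ?_
  rw [← sub_le_iff_le_add]
  refine le_liminf_of_le hcob ?_
  have hd' : (0 : ℝ) < d := by exact_mod_cast hd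
  -- There are at most `d * N` edges, so the term `E x` becomes `ε / 4 * N`; the next choice of `δ`
  -- does the same for `j * |log x|` with `j ≤ δ * N`.
  set x : ℝ := ε / (4 * d) with hx
  have hxpos : 0 < x := by positivity
  set δ : ℝ := ε / (4 * (|Real.log x| + 1)) with hδ
  have hδpos : 0 < δ := by positivity
  obtain ⟨b, L, hb, hL, hL1, hLδ, hX⟩ := h (ε / 4) (by positivity) δ hδpos
  set n := boxSize b with hn
  have hnpos : 0 < n := boxSize_pos hb
  have hn' : (0 : ℝ) < n := by exact_mod_cast hnpos
  -- An even number of copies in each direction, so that the filled box has even sides as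
  -- `exists_boxCount_le` requires.
  let a : (Fin d → ℕ) → Fin d → ℕ := fun m k => 2 * (m k / (2 * b k))
  have hθ : Tendsto (fun s : (Fin d → ℕ) × ℕ => ((∏ k, a s.1 k : ℕ) : ℝ) * n / boxSize s.1)
      (densityFilter d p) (𝓝 1) := by
    have h1 : Tendsto (fun s : (Fin d → ℕ) × ℕ =>
        ∏ k, ((2 * b k * (s.1 k / (2 * b k)) : ℕ) : ℝ) / s.1 k) (densityFilter d p)
        (𝓝 (∏ _k : Fin d, 1)) := tendsto_finsetProd _ fun k _ =>
      (tendsto_mul_div_self (by have := hb k; omega : 0 < 2 * b k)).comp (tendsto_side k)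
    rw [Finset.prod_const_one] at h1
    refine h1.congr fun s => ?_
    rw [Finset.prod_div_distrib, hn]
    simp only [boxSize, a]
    push_cast
    rw [← Finset.prod_mul_distrib]
    congr 1
    exact Finset.prod_congr rfl fun k _ => by ring
  set β : ℝ := 2 * L / n with hβ
  set c : ℝ := Real.log (boxCount b L) / n with hc
  have hβ1 : β ≤ 1 := by
    rw [hβ, div_le_one hn']
    exact_mod_cast hL1
  have hβδ : β ≤ p + δ := by
    rw [hβ, div_le_iff₀ hn']
    exact hLδ
  have hcX : X - ε / 4 ≤ c := by
    rw [hc, le_div_iff₀ hn']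
    exact hX
  -- Up to rounding, `1 + θ (β - 1)` is the dimer density after filling, where `θ → 1` is the
  -- proportion taken up by the copies. The surplus density tends to `β - p ≤ δ`.
  have hj : Tendsto (fun s : (Fin d → ℕ) × ℕ =>
      1 + ((∏ k, a s.1 k : ℕ) : ℝ) * n / boxSize s.1 * (β - 1) - 2 * (s.2 : ℝ) / boxSize s.1)
      (densityFilter d p) (𝓝 (1 + 1 * (β - 1) - p)) :=
    ((hθ.mul_const _).const_add 1).sub tendsto_density
  have hj' := hj.eventually_lt_const (by linarith : 1 + 1 * (β - 1) - p < 2 * δ)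
  have hcθ := (hθ.mul_const c).eventually_const_lt (by linarith : c - ε / 4 < 1 * c)
  -- This ensures `l ≤ t` below. A perfect block leaves at most one monomer, so `t` is maximal;
  -- otherwise half the excess `β - p` of the density amounts to at least one point and pays for the
  -- monomer.
  have hlt : ∀ᶠ s in densityFilter d p, 2 * L = n ∨ (2 * (s.2 : ℝ) / boxSize s.1 < (p + β) / 2 ∧
      2 / (β - p) ≤ (boxSize s.1 : ℝ) ∧ p < β) := by
    rcases hL with hL | hL
    · have hpβ : p < β := by
        rw [hβ, lt_div_iff₀ hn']
        exact hL
      filter_upwards [tendsto_density.eventually_lt_const (by linarith : p < (p + β) / 2),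
        (tendsto_boxSize hd).eventually_ge_atTop (2 / (β - p))] with s h1 h2
      exact Or.inr ⟨h1, h2, hpβ⟩
    · exact Eventually.of_forall fun s => Or.inl hL
  filter_upwards [eventually_pos, eventually_two_mul_le, hj', hcθ, hlt] with s hs hl hj hcθ hlt
  obtain ⟨m, l⟩ := s
  simp only at hs hl hj hcθ hlt
  set A := ∏ k, a m k with hA
  have hN : (0 : ℝ) < boxSize m := by exact_mod_cast boxSize_pos hs
  have hfill := boxCount_pow_le b (a m) L
  obtain ⟨t, ht1, ht2, ht3⟩ := exists_boxCount_le (b := fun k => a m k * b k) (m := m)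
    (fun k => by simp [a]) (fun k => by
      calc a m k * b k = 2 * b k * (m k / (2 * b k)) := by
            simp only [a]
            ring
        _ ≤ m k := Nat.mul_div_le _ _) (A * L)
  have hsz : boxSize (fun k => a m k * b k) = A * n := by
    simp [boxSize, hA, hn, Finset.prod_mul_distrib]
  rw [hsz] at ht2 ht3
  have hAn : (A : ℝ) * n ≤ boxSize m := by
    have h1 : 2 * (A * L) ≤ A * n := by
      calc 2 * (A * L) = A * (2 * L) := by ring
        _ ≤ _ := Nat.mul_le_mul_left _ hL1
    have h2 : boxSize (fun k => a m k * b k) ≤ boxSize m := by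
      refine Finset.prod_le_prod' fun k _ => ?_
      calc a m k * b k = 2 * b k * (m k / (2 * b k)) := by
            simp only [a]
            ring
        _ ≤ m k := Nat.mul_div_le _ _
    rw [hsz] at h2
    exact_mod_cast h2
  have hLβ : 2 * (L : ℝ) = β * n := by
    rw [hβ]
    field_simp
  have hlt' : l ≤ t := by
    rcases hlt with hlt | ⟨h1, h2, h3⟩
    · have : 2 * (A * L) = A * n := by
        rw [← hlt]
        ring
      omega
    · rw [div_lt_iff₀ hN] at h1
      rw [div_le_iff₀ (by linarith)] at h2
      have ht3' : (boxSize m : ℝ) + 2 * (A * L) ≤ 2 * t + A * n + 1 := by exact_mod_cast ht3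
      have h4 : (A : ℝ) * n * (1 - β) ≤ boxSize m * (1 - β) :=
        mul_le_mul_of_nonneg_right hAn (by linarith)
      have h5 : 2 * ((A : ℝ) * L) = A * n * β := by linear_combination (A : ℝ) * hLβ
      have : (2 * l : ℝ) ≤ 2 * t := by nlinarith
      have : 2 * l ≤ 2 * t := by exact_mod_cast this
      omega
  have hjm : ((t - l : ℕ) : ℝ) ≤ δ * boxSize m := by
    rw [Nat.cast_sub hlt']
    have ht2' : 2 * (t : ℝ) + A * n ≤ boxSize m + 2 * (A * L) := by exact_mod_cast ht2
    have h5 : 2 * ((A : ℝ) * L) = A * n * β := by linear_combination (A : ℝ) * hLβ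
    have h6 : (boxSize m : ℝ) * (1 + (A : ℝ) * n / boxSize m * (β - 1) - 2 * (l : ℝ) / boxSize m) =
        boxSize m + A * n * (β - 1) - 2 * l := by
      field_simp
    have h7 := mul_lt_mul_of_pos_left hj hN
    rw [h6] at h7
    nlinarith
  have hrem := boxCount_add_le m l (t - l)
  rw [Nat.add_sub_cancel' hlt'] at hrem
  have hp1 : (0 : ℝ) < boxCount b L := by exact_mod_cast boxCount_pos hL1
  have hp2 : (0 : ℝ) < boxCount m l := by exact_mod_cast boxCount_pos hl
  have hchoose : 0 < (d * boxSize m).choose (t - l) := by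
    refine Nat.pos_of_ne_zero fun h0 => ?_
    rw [h0, mul_zero] at hrem
    have := (Nat.pow_pos (n := A) (boxCount_pos hL1)).trans_le (hfill.trans ht1)
    omega
  have hlog : A * Real.log (boxCount b L) ≤
      Real.log (boxCount m l) + Real.log ((d * boxSize m).choose (t - l)) := by
    rw [← Real.log_pow, ← Real.log_mul hp2.ne' (by exact_mod_cast hchoose.ne')]
    refine Real.log_le_log (by positivity) ?_
    exact_mod_cast hfill.trans (ht1.trans hrem)
  have hent := log_choose_le_of_pos (d * boxSize m) (t - l)
    (by by_contra hh; rw [Nat.choose_eq_zero_of_lt (by omega)] at hchoose; omega) hxpos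
  rw [logCount_eq hs, le_div_iff₀ hN]
  simp only
  have e1 : ((d * boxSize m : ℕ) : ℝ) * x = ε / 4 * boxSize m := by
    rw [hx]
    push_cast
    field_simp
  have e2 : -(((t - l : ℕ) : ℝ) * Real.log x) ≤ ε / 4 * boxSize m := by
    calc -(((t - l : ℕ) : ℝ) * Real.log x) = ((t - l : ℕ) : ℝ) * (-Real.log x) := by ring
      _ ≤ ((t - l : ℕ) : ℝ) * (|Real.log x| + 1) := by
          gcongr
          linarith [neg_le_abs (Real.log x)]
      _ ≤ δ * boxSize m * (|Real.log x| + 1) := by gcongr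
      _ = ε / 4 * boxSize m := by
          rw [hδ]
          field_simp
  have e3 : (A : ℝ) * Real.log (boxCount b L) = A * n * c := by
    rw [hc]
    field_simp
  have e4 : (c - ε / 4) * boxSize m ≤ A * n * c := by
    have := mul_lt_mul_of_pos_right hcθ hN
    rw [show (A : ℝ) * n / boxSize m * c * boxSize m = A * n * c by field_simp] at this
    exact this.le
  have e5 : (X - ε / 4) * boxSize m ≤ c * boxSize m := by gcongr
  linarith

end Limits

/-! ### Choice of blocks and the layer inequality. -/

section LayerBound

variable {d : ℕ}

theorem frequently_lt_logCount (hd : 1 ≤ d) {q : ℝ} (hq : q ∈ Set.Icc (0 : ℝ) 1) {T : ℝ}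
    (hT : T < upperEntropy d q) : ∃ᶠ s in densityFilter d q, T < logCount s := by
  have := densityFilter_neBot hd hq
  refine frequently_lt_of_lt_limsup ?_ hT
  exact (isBoundedUnder_of_eventually_ge (a := 0)
    (Eventually.of_forall logCount_nonneg)).isCoboundedUnder_le

theorem tendsto_log_add_one_div : Tendsto (fun x : ℝ => (Real.log x + 1) / x) atTop (𝓝 0) := by
  have h1 : Tendsto (fun x : ℝ => Real.log x / x) atTop (𝓝 0) :=
    Real.isLittleO_log_id_atTop.tendsto_div_nhds_zero
  have h2 := h1.add (tendsto_inv_atTop_zero (𝕜 := ℝ))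
  rw [add_zero] at h2
  refine h2.congr fun x => ?_
  rw [add_div, one_div]

theorem tendsto_rate {α : Type*} {F : Filter α} {u v : α → ℝ} {a b : ℝ} (hu : Tendsto u F (𝓝 a))
    (hv : Tendsto v F (𝓝 b)) : Tendsto (fun x => rate (u x) (v x)) F (𝓝 (rate a b)) :=
  Tendsto.comp (g := fun p : ℝ × ℝ => rate p.1 p.2) (continuous_rate.tendsto (a, b))
    (hu.prodMk_nhds hv)

theorem exists_lt_two_pow (x : ℝ) : ∃ k : ℕ, x < 2 ^ k := pow_unbounded_of_one_lt x one_lt_two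

/-- Crossing sets of density `(p - q) / 2 + η` give density about `p + 2 * η`; the room below `1`
and continuity of `rate` permit this for small `η`. -/
theorem exists_block_of_lt_one (hd : 1 ≤ d) {p q : ℝ} (hq : q ∈ Set.Icc (0 : ℝ) p) (hp : p < 1)
    {ε δ : ℝ} (hε : 0 < ε) (hδ : 0 < δ) :
    ∃ (b : Fin (d + 1) → ℕ) (L : ℕ), (∀ k, 0 < b k) ∧ p * boxSize b < 2 * L ∧
      2 * L ≤ boxSize b ∧ 2 * L ≤ (p + δ) * boxSize b ∧
      (upperEntropy d q + rate (1 - q) ((p - q) / 2) - ε) * boxSize b ≤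
        Real.log (boxCount b L) := by
  set R := rate (1 - q) ((p - q) / 2) with hR
  set T := upperEntropy d q with hT
  obtain ⟨hq0, hqp⟩ := hq
  have hcont : Tendsto (fun η : ℝ => rate (1 - q) ((p - q) / 2 + η)) (𝓝[>] 0) (𝓝 R) := by
    have h : Tendsto (fun η : ℝ => (p - q) / 2 + η) (𝓝[>] 0) (𝓝 ((p - q) / 2 + 0)) :=
      (tendsto_id.mono_left nhdsWithin_le_nhds).const_add _
    rw [add_zero] at h
    exact tendsto_rate tendsto_const_nhds h
  have hmin : (0 : ℝ) < min (δ / 3) ((1 - p) / 3) := lt_min (by linarith) (by linarith)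
  obtain ⟨η, hηR, hη0, hη1⟩ := ((hcont.eventually_const_lt (by linarith : R - ε / 4 < R)).and
    (eventually_mem_set.2 (Ioo_mem_nhdsGT hmin))).exists
  have hηδ := hη1.trans_le (min_le_left _ _)
  have hηp := hη1.trans_le (min_le_right _ _)
  set ρ := (p - q) / 2 + η with hρ
  have hρ0 : 0 < ρ := by linarith
  have hfl : Tendsto (fun s : (Fin d → ℕ) × ℕ => ((⌊ρ * boxSize s.1⌋₊ : ℕ) : ℝ) / boxSize s.1)
      (densityFilter d q) (𝓝 ρ) :=
    (tendsto_nat_floor_mul_div_atTop hρ0.le).comp (tendsto_boxSize hd)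
  have hrate : Tendsto (fun s : (Fin d → ℕ) × ℕ => rate (1 - 2 * (s.2 : ℝ) / boxSize s.1)
      (((⌊ρ * boxSize s.1⌋₊ : ℕ) : ℝ) / boxSize s.1)) (densityFilter d q) (𝓝 (rate (1 - q) ρ)) :=
    tendsto_rate (tendsto_density.const_sub 1) hfl
  have herr := (tendsto_log_add_one_div.const_mul 3).comp (tendsto_boxSize (p := q) hd)
  rw [mul_zero] at herr
  have hdens := tendsto_density.add (hfl.const_mul 2)
  obtain ⟨⟨m, l⟩, h1, hs, h2, h3, h4, h5⟩ := ((frequently_lt_logCount hd ⟨hq0, by linarith⟩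
    (by linarith : T - ε / 8 < upperEntropy d q)).and_eventually (eventually_pos.and
    ((hrate.eventually_const_lt hηR).and ((herr.eventually_lt_const
      (by linarith : (0 : ℝ) < ε / 8)).and
    ((hdens.eventually_const_lt (by linarith : p + η < q + 2 * ρ)).and
      (hdens.eventually_lt_const (by linarith : q + 2 * ρ < p + 3 * η))))))).exists
  simp only [Function.comp_apply] at h1 hs h2 h3 h4 h5
  rw [logCount_eq hs] at h1
  simp only at h1
  set r := ⌊ρ * boxSize m⌋₊ with hr
  have hNn := boxSize_pos hs
  have hN : (0 : ℝ) < boxSize m := by exact_mod_cast hNn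
  rw [show 2 * (l : ℝ) / boxSize m + 2 * ((r : ℝ) / boxSize m) = (2 * l + 2 * r) / boxSize m by ring]
    at h4 h5
  rw [lt_div_iff₀ hN] at h4
  rw [div_lt_iff₀ hN] at h5
  have hle : 2 * l + 2 * r ≤ boxSize m := by
    have : (2 * l + 2 * r : ℝ) ≤ boxSize m := h5.le.trans (by nlinarith)
    exact_mod_cast this
  -- Only `2 ^ k - 1` joints occur in `2 ^ k` layers. The missing one costs density at most `1 / 2 ^
  -- k < η`, so the density stays above `p`; the second bound absorbs the term `log 2` into `ε`.
  obtain ⟨k, hk⟩ := exists_lt_two_pow (max (1 / η) (4 * Real.log 2 / ε))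
  have hk1 := (le_max_left _ _).trans_lt hk
  have hk2 := (le_max_right _ _).trans_lt hk
  rw [div_lt_iff₀ hη0] at hk1
  rw [div_lt_iff₀ hε] at hk2
  have hK : (0 : ℝ) < 2 ^ k := by positivity
  have hbase := log_boxCount_cons_ge m hNn hle k
  have hsize : ((boxSize (Fin.cons (2 ^ k) m : Fin (d + 1) → ℕ) : ℕ) : ℝ) = 2 ^ k * boxSize m := by
    rw [boxSize_cons]
    push_cast
    ring
  have hLc : 2 * ((2 ^ k * l + (2 ^ k - 1) * r : ℕ) : ℝ) = 2 ^ k * (2 * l + 2 * r) - 2 * r := by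
    have : 1 ≤ 2 ^ k := Nat.one_le_two_pow
    push_cast [this]
    ring
  have hrN : (2 * r : ℝ) ≤ boxSize m := by exact_mod_cast (by omega : 2 * r ≤ boxSize m)
  refine ⟨Fin.cons (2 ^ k) m, 2 ^ k * l + (2 ^ k - 1) * r, ?_, ?_, ?_, ?_, ?_⟩
  · exact Fin.cases (by simp) (by simpa using hs)
  · rw [hsize, hLc]
    have h6 := mul_lt_mul_of_pos_left h4 hK
    have h7 := mul_lt_mul_of_pos_right hk1 hN
    nlinarith
  · rw [boxSize_cons]
    calc 2 * (2 ^ k * l + (2 ^ k - 1) * r) ≤ 2 * (2 ^ k * l + 2 ^ k * r) := by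
          gcongr
          exact Nat.sub_le _ _
      _ = 2 ^ k * (2 * l + 2 * r) := by ring
      _ ≤ _ := Nat.mul_le_mul_left _ hle
  · rw [hsize, hLc]
    have h6 := mul_lt_mul_of_pos_left h5 hK
    have h7 : 2 ^ k * ((3 * η) * boxSize m) ≤ 2 ^ k * (δ * boxSize m) := by
      gcongr
      linarith
    have : (0 : ℝ) ≤ r := Nat.cast_nonneg _
    linarith
  · rw [hsize]
    rw [lt_div_iff₀ hN] at h1
    rw [← mul_div_assoc, div_lt_iff₀ hN] at h3
    have h6 := mul_lt_mul_of_pos_left h2 hN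
    have h7 : 2 ^ k * ((T + R - 3 * ε / 4) * boxSize m) ≤ 2 ^ k * (Real.log (boxCount m l) +
        boxSize m * rate (1 - 2 * l / boxSize m) (r / boxSize m) -
        3 * (Real.log (boxSize m) + 1)) := by
      refine mul_le_mul_of_nonneg_left ?_ hK.le
      have h8 : ε * boxSize m ≥ 0 := by positivity
      linarith
    have h8 := mul_lt_mul_of_pos_right hk2 hN
    linarith

theorem exists_perfect_block (hd : 1 ≤ d) {q : ℝ} (hq : q ∈ Set.Icc (0 : ℝ) 1)
    {ε : ℝ} (hε : 0 < ε) :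
    ∃ (b : Fin (d + 1) → ℕ) (L : ℕ), (∀ k, 0 < b k) ∧ 2 * L = boxSize b ∧
      (upperEntropy d q + rate (1 - q) ((1 - q) / 2) - ε) * boxSize b ≤
        Real.log (boxCount b L) := by
  set R := rate (1 - q) ((1 - q) / 2) with hR
  set T := upperEntropy d q with hT
  have hrate : Tendsto (fun s : (Fin d → ℕ) × ℕ => rate (1 - 2 * (s.2 : ℝ) / boxSize s.1)
      ((1 - 2 * (s.2 : ℝ) / boxSize s.1) / 2)) (densityFilter d q) (𝓝 R) := by
    have h := (tendsto_density (d := d) (p := q)).const_sub 1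
    exact tendsto_rate h (h.div_const 2)
  have herr := (tendsto_log_add_one_div.const_mul 5).comp
    ((tendsto_boxSize (p := q) hd).const_mul_atTop (by norm_num : (0 : ℝ) < 4))
  rw [mul_zero] at herr
  obtain ⟨⟨m, l⟩, h1, hs, hl, h2, h3⟩ := ((frequently_lt_logCount hd hq
    (by linarith : T - ε / 4 < upperEntropy d q)).and_eventually (eventually_pos.and
    (eventually_two_mul_le.and ((hrate.eventually_const_lt (by linarith : R - ε / 4 < R)).and
    (herr.eventually_lt_const (by linarith : (0 : ℝ) < ε / 4)))))).exists
  simp only [Function.comp_apply] at h1 hs hl h2 h3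
  rw [logCount_eq hs] at h1
  simp only at h1
  have hNn := boxSize_pos hs
  have hN : (0 : ℝ) < boxSize m := by exact_mod_cast hNn
  set i : Fin d := ⟨0, hd⟩
  -- Quadrupling a side gives `2 * (4 * l) + 4 * s = boxSize m'` with `s = boxSize m - 2 * l`, so no
  -- divisibility condition on the layer is needed.
  set m' := Function.update m i (4 * m i) with hm'
  have hsz : boxSize m' = 4 * boxSize m := by
    have := boxSize_update m i (4 * m i)
    have hi := hs i
    refine Nat.eq_of_mul_eq_mul_right hi ?_
    rw [hm', this]
    ring
  have hs' : ∀ k, 0 < m' k := fun k => by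
    by_cases hk : k = i
    · subst hk
      simpa [hm'] using hs _
    · simpa [hm', hk] using hs k
  set s := boxSize m - 2 * l with hsdef
  have hpow := boxCount_pow_update m i l 4
  have hp1 : (0 : ℝ) < boxCount m l := by exact_mod_cast boxCount_pos hl
  have hlog4 : 4 * Real.log (boxCount m l) ≤ Real.log (boxCount m' (4 * l)) := by
    have h := Real.log_le_log (by positivity)
      (by exact_mod_cast hpow : (boxCount m l : ℝ) ^ 4 ≤ boxCount m' (4 * l))
    rw [Real.log_pow] at h
    exact_mod_cast h
  -- The caps are credited with no entropy. Their height `4 * s + 2` is fixed before `k`, so the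
  -- loss `Y * (4 * s + 2)` disappears for large `k`; the maximum with `0` guards against a negative
  -- target.
  set Y := max 0 (T + R - ε) with hY
  obtain ⟨k, hk⟩ := exists_lt_two_pow (4 * (Real.log 2 + Y * (4 * s + 2)) / ε)
  rw [div_lt_iff₀ hε] at hk
  have hK : (0 : ℝ) < 2 ^ k := by positivity
  obtain ⟨L, hL, hbase⟩ := log_boxCount_cons_perfect_ge m' (l := 4 * l) (s := s)
    (by omega) (by omega) k
  have hsR : (s : ℝ) = boxSize m - 2 * l := by
    rw [hsdef, Nat.cast_sub hl]
    push_cast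
    ring
  have a1 : 1 - 2 * ((4 * l : ℕ) : ℝ) / boxSize m' = 1 - 2 * l / boxSize m := by
    rw [hsz]
    push_cast
    field_simp
  have a2 : ((2 * s : ℕ) : ℝ) / boxSize m' = (1 - 2 * l / boxSize m) / 2 := by
    rw [hsz]
    push_cast
    rw [hsR]
    field_simp
    ring
  have hsz' : (boxSize m' : ℝ) = 4 * boxSize m := by
    rw [hsz]
    push_cast
    ring
  rw [a1, a2, hsz'] at hbase
  refine ⟨Fin.cons (2 ^ k + 4 * s + 2) m', L, ?_, ?_, ?_⟩
  · exact Fin.cases (by simp) (by simpa using hs')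
  · rw [boxSize_cons, hL]
  · have hsize : ((boxSize (Fin.cons (2 ^ k + 4 * s + 2) m' : Fin (d + 1) → ℕ) : ℕ) : ℝ) =
        (2 ^ k + 4 * s + 2) * (4 * boxSize m) := by
      rw [boxSize_cons, hsz]
      push_cast
      ring
    rw [hsize]
    rw [lt_div_iff₀ hN] at h1
    rw [← mul_div_assoc, div_lt_iff₀ (by positivity)] at h3
    have h6 := mul_lt_mul_of_pos_left h2 hN
    have h7 : 2 ^ k * ((T + R - 3 * ε / 4) * (4 * boxSize m)) ≤ 2 ^ k *
        (Real.log (boxCount m' (4 * l)) +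
        4 * boxSize m * rate (1 - 2 * l / boxSize m) ((1 - 2 * l / boxSize m) / 2) -
        5 * (Real.log (4 * boxSize m) + 1)) := by
      refine mul_le_mul_of_nonneg_left ?_ hK.le
      linarith
    have h8 : (T + R - ε) * (4 * s + 2) ≤ Y * (4 * s + 2) := by
      gcongr
      exact le_max_right _ _
    have h9 : (T + R - ε) * (2 ^ k + 4 * s + 2) ≤ 2 ^ k * (T + R - 3 * ε / 4) - Real.log 2 := by
      linarith
    have h10 := mul_le_mul_of_nonneg_right h9 (by positivity : (0 : ℝ) ≤ 4 * boxSize m)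
    linarith

theorem upperEntropy_add_rate_le (hd : 1 ≤ d) {p q : ℝ} (hp : p ∈ Set.Icc (0 : ℝ) 1)
    (hq : q ∈ Set.Icc (0 : ℝ) p) :
    upperEntropy d q + rate (1 - q) ((p - q) / 2) ≤ lowerEntropy (d + 1) p := by
  refine le_lowerEntropy (by omega) hp fun ε hε δ hδ => ?_
  -- Only at `p = 1` is it impossible to overshoot the density.
  rcases hp.2.lt_or_eq with hp1 | rfl
  · obtain ⟨b, L, h1, h2, h3, h4, h5⟩ := exists_block_of_lt_one hd hq hp1 hε hδ
    exact ⟨b, L, h1, Or.inl h2, h3, h4, h5⟩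
  · obtain ⟨b, L, h1, h2, h3⟩ := exists_perfect_block hd hq hε
    refine ⟨b, L, h1, Or.inr h2, h2.le, ?_, h3⟩
    have h4 : (2 * L : ℝ) = boxSize b := by exact_mod_cast h2
    rw [h4]
    have : (0 : ℝ) ≤ boxSize b := Nat.cast_nonneg _
    nlinarith

end LayerBound

end MonomerDimer

end

theorem theorem3p1 (d : ℕ) (hd : 2 ≤ d) (p : ℝ) (hp : p ∈ Set.Icc (0 : ℝ) 1) :
    (∀ q ∈ Set.Icc (0 : ℝ) p,
      MonomerDimer.lowerEntropy d p ≥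
        MonomerDimer.upperEntropy (d - 1) q
          + (1 - q) * Real.log (1 - q)
          - (p - q) / 2 * Real.log ((p - q) / 2)
          + (1 - (p - q) / 2) * Real.log (1 - (p - q) / 2)
          - (1 - p) * Real.log (1 - p)) ∧
    MonomerDimer.lowerEntropy d p ≥
      MonomerDimer.upperEntropy (d - 1) (p * (1 - 1 / (d : ℝ)))
        + (1 - p * (1 - 1 / (d : ℝ))) * Real.log (1 - p * (1 - 1 / (d : ℝ)))
        - p / (2 * (d : ℝ)) * Real.log (p / (2 * (d : ℝ)))
        + (1 - p / (2 * (d : ℝ))) * Real.log (1 - p / (2 * (d : ℝ)))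
        - (1 - p) * Real.log (1 - p) := by
  have main : ∀ q ∈ Set.Icc (0 : ℝ) p,
      MonomerDimer.lowerEntropy d p ≥
        MonomerDimer.upperEntropy (d - 1) q
          + (1 - q) * Real.log (1 - q)
          - (p - q) / 2 * Real.log ((p - q) / 2)
          + (1 - (p - q) / 2) * Real.log (1 - (p - q) / 2)
          - (1 - p) * Real.log (1 - p) := by
    intro q hq
    have h := MonomerDimer.upperEntropy_add_rate_le (d := d - 1) (by omega) hp hq
    rw [Nat.sub_add_cancel (by omega), MonomerDimer.rate,
      show 1 - q - 2 * ((p - q) / 2) = 1 - p by ring] at h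
    linarith
  refine ⟨main, ?_⟩
  have hd' : (2 : ℝ) ≤ d := by exact_mod_cast hd
  have h1 : 0 ≤ 1 / (d : ℝ) := by positivity
  have h2 : 1 / (d : ℝ) ≤ 1 := by
    rw [div_le_one (by linarith)]
    linarith
  have h := main (p * (1 - 1 / (d : ℝ)))
    ⟨mul_nonneg hp.1 (by linarith), mul_le_of_le_one_right hp.1 (by linarith)⟩
  rwa [show (p - p * (1 - 1 / (d : ℝ))) / 2 = p / (2 * (d : ℝ)) by field_simp; ring] at h
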